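/- Call a non-decreasing function $f:(0,1]\to(0,1]$ a hierarchy function. For a finite graph $F$: a cut of $F$ is a partition $\{X,Y\}$ of $V(F)$ into two non-empty sets; it is $\alpha$-sparse if at most $\alpha|X||Y|$ edges of $F$ join $X$ to $Y$. $F$ is bipartite and balanced if $V(F)$ can be partitioned into two independent sets of equal size. A perfect $K_{t,t}$-packing in $F$ is a collection of pairwise vertex-disjoint subgraphs of $F$, each isomorphic to $K_{t,t}$, that together cover $V(F)$. The subgraph of $F$ induced by $S\subseteq V(F)$ is denoted by $F[S]$. Let $f_0,f_1,f_2,f_3$ be hierarchy functions, let $0<c\le 1$ and let $t\ge 2$ be an integer. Then, for every sufficiently large integer $n_0$ (depending only on $c$, $t$ and $f_0,\dots,f_3$), the following holds. Let $G$ be a $d$-regular graph on $n$ vertices, where $n\ge n_0$ and $d\ge cn$. Then there exist real numbers $\eta,\zeta,\gamma>0$ and an integer $r$ with $1\le r\le\lceil 1/c\rceil$ such that $$\frac1{n_0}\le f_0(\eta),\qquad \eta\le f_1(\zeta),\qquad \zeta\le f_2(\gamma),\qquad \gamma\le f_3\bigl(\min\{c,1/t\}\bigr)$$ (that is, $1/n_0\ll\eta\ll\zeta\ll\gamma\ll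 c,1/t$), and there exist pairwise disjoint sets $Z_1,\dots,Z_r,L\subseteq V(G)$, with every $Z_i$ non-empty, and a spanning subgraph $G'\subseteq G$ with the following properties. 1. $\displaystyle |V(G)\setminus(Z_1\cup\dots\cup Z_r\cup L)|\le 64r^2\cdot\frac tc\cdot\Bigl(\frac{e}{8\zeta}\Bigr)^t$, where $e$ is the base of the natural logarithm. 2. For every $i\in\{1,\dots,r\}$, the graph $G'[Z_i]$ has average degree at least $d-\eta|Z_i|$. 3. For every $i\in\{1,\dots,r\}$, the graph $G'[Z_i]$ has no $\zeta$-sparse cuts. 4. For every $i\in\{1,\dots,r\}$, the graph $G'[Z_i]$ is either bipartite and balanced, or at least $\gamma n^2$ edges have to be removed from it to make it bipartite. 5. $G[L]$ has a perfect $K_{t,t}$-packing. -/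

import Mathlib

namespace DenseRegular

/-- The functions that calibrate a hierarchy of constants `a ≪ b`: non-decreasing maps
`(0, 1] → (0, 1]`. The values outside `(0, 1]` play no role. -/
structure IsHierarchyFunction (f : ℝ → ℝ) : Prop where
  mapsTo : Set.MapsTo f (Set.Ioc 0 1) (Set.Ioc 0 1)
  monotoneOn : MonotoneOn f (Set.Ioc 0 1)

variable {V : Type*}

open Classical in
/-- The average degree of a (non-empty) finite graph. -/
noncomputable def averageDegree [Fintype V] (G : SimpleGraph V) : ℝ :=
  (∑ v, (G.degree v : ℝ)) / Fintype.card V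

open Classical in
/-- The cut `{X, V ∖ X}` (both sides non-empty) is `α`-sparse if it is crossed by at most
`α |X| |V ∖ X|` edges. -/
def IsSparseCut [Fintype V] (G : SimpleGraph V) (α : ℝ) (X : Finset V) : Prop :=
  X.Nonempty ∧ Xᶜ.Nonempty ∧
    ((G.interedges X Xᶜ).card : ℝ) ≤ α * (X.card : ℝ) * (Xᶜ.card : ℝ)

/-- `G` has no `α`-sparse cuts. -/
def NoSparseCuts [Fintype V] (G : SimpleGraph V) (α : ℝ) : Prop :=
  ∀ X : Finset V, ¬ IsSparseCut G α X

/-- `G` is bipartite and balanced: its vertex set is the disjoint union of two independent sets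
of the same size. -/
def IsBalancedBipartite (G : SimpleGraph V) : Prop :=
  ∃ X Y : Set V, G.IsBipartiteWith X Y ∧ X ∪ Y = Set.univ ∧ X.ncard = Y.ncard

/-- At least `m` edges have to be removed from `G` to make it bipartite. -/
def IsFarFromBipartite (G : SimpleGraph V) (m : ℝ) : Prop :=
  ∀ E : Set (Sym2 V), E ⊆ G.edgeSet → (G.deleteEdges E).IsBipartite → m ≤ (E.ncard : ℝ)

/-- `G` has a perfect `H`-packing: a collection of pairwise vertex-disjoint subgraphs of `G`, each
isomorphic to `H`, covering all vertices of `G`. -/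
def HasPerfectPacking {W : Type*} (H : SimpleGraph W) (G : SimpleGraph V) : Prop :=
  ∃ 𝒦 : Set G.Subgraph,
    (∀ K ∈ 𝒦, Nonempty (K.coe ≃g H)) ∧
    𝒦.PairwiseDisjoint SimpleGraph.Subgraph.verts ∧
    (⋃ K ∈ 𝒦, K.verts) = Set.univ

end DenseRegular

/-!
Label the vertices by clusters, some of them marked as bipartite and split into two sides, and call
an edge lost if it leaves its cluster or lies inside a side of a marked cluster. Start with a single
cluster. As long as some cluster has a sparse cut, or an unmarked cluster is close to bipartite,
split or mark it: few edges get lost, the vertices keep linear degree, and the number of clusters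
plus the number of marked ones grows. Clusters cannot be much smaller than `d`, so this number is at
most `2 ⌈1 / c⌉`, and the process ends at one of boundedly many scales `(η, ζ, γ)`.

It remains to balance the marked clusters. Since `G` is `d`-regular, `d` times the imbalance of a
marked cluster is a signed count of the ends of lost edges. Consider a copy of `K_{t,t}` in which
one class consists of lost neighbours of a vertex `v`, all of the same label, and the other class
of `v` and of `t - 1` vertices that are joined to the first class by kept edges. Removing it
changes the imbalances as the removal of the two ends of one lost edge would. So if `e` edges are
lost between two classes of vertices, remove about `e / d` disjoint copies that belong to these
classes. This balances all marked clusters up to a bounded number of vertices, which are dropped as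
well. The copies are found greedily: first those for classes with few lost edges between them, and
last those around vertices of linear lost degree.
-/

namespace DenseRegular

open Finset
open scoped Classical

universe u

section Degrees

variable {V : Type*}

lemma card_interedges_comm (H : SimpleGraph V) (A B : Finset V) :
    #(H.interedges A B) = #(H.interedges B A) :=
  have := H.symm
  Rel.card_interedges_comm A B

variable [Fintype V]

lemma degree_add_degree_of_disjoint {A B H : SimpleGraph V} (hAB : Disjoint A B)
    (hsup : A ⊔ B = H) (v : V) : A.degree v + B.degree v = H.degree v := by
  simp only [← SimpleGraph.card_neighborFinset_eq_degree]
  rw [← card_union_of_disjoint]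
  · congr 1
    ext u
    simp [← hsup]
  · refine disjoint_left.2 fun u huA huB => ?_
    rw [SimpleGraph.mem_neighborFinset] at huA huB
    exact SimpleGraph.disjoint_left.1 hAB v u huA huB

lemma degree_le_card (H : SimpleGraph V) (v : V) : H.degree v ≤ Fintype.card V :=
  (H.degree_lt_card_verts v).le

lemma card_interedges_eq_sum (H : SimpleGraph V) (A B : Finset V) :
    #(H.interedges A B) = ∑ v ∈ A, #(H.neighborFinset v ∩ B) := by
  rw [SimpleGraph.interedges_def, card_filter, sum_product]
  refine sum_congr rfl fun v _ => ?_
  rw [← card_filter]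
  congr 1
  ext u
  simp [and_comm]

/-- A vertex of `A` has few neighbours in `B` on average, so it has many in `A`. -/
lemma sub_le_card_of_card_interedges_le {H : SimpleGraph V} {A B : Finset V} {δ α : ℝ}
    (hA : A.Nonempty) (hclosed : ∀ v ∈ A, H.neighborFinset v ⊆ A ∪ B)
    (hdeg : ∀ v ∈ A, δ ≤ H.degree v) (hcut : (#(H.interedges A B) : ℝ) ≤ α * #A) :
    δ - α ≤ #A := by
  have hsum : ∑ v ∈ A, H.degree v ≤ #A * #A + #(H.interedges A B) :=
    calc ∑ v ∈ A, H.degree v ≤ ∑ v ∈ A, (#A + #(H.neighborFinset v ∩ B)) := by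
          refine sum_le_sum fun v hv => ?_
          rw [← SimpleGraph.card_neighborFinset_eq_degree]
          nth_rw 1 [← inter_eq_left.2 (hclosed v hv), inter_union_distrib_left]
          exact (card_union_le _ _).trans (by gcongr; exact inter_subset_right)
      _ = #A * #A + #(H.interedges A B) := by
          rw [sum_add_distrib, sum_const, smul_eq_mul, card_interedges_eq_sum]
  have hsum' : (#A : ℝ) * δ ≤ #A * (#A + α) :=
    calc (#A : ℝ) * δ ≤ ∑ v ∈ A, (H.degree v : ℝ) := by
          simpa using card_nsmul_le_sum A _ δ hdeg
      _ ≤ #A * #A + #(H.interedges A B) := by exact_mod_cast hsum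
      _ ≤ #A * (#A + α) := by linarith
  have := le_of_mul_le_mul_left hsum' (by exact_mod_cast hA.card_pos)
  linarith

end Degrees

section Parity

variable {V : Type*}

/-- The subgraph of the edges on which the two-colouring `s` has the parity `x`: the monochromatic
edges for `x = false`, the bichromatic ones for `x = true`. -/
def parityPart (H : SimpleGraph V) (s : V → Bool) (x : Bool) : SimpleGraph V where
  Adj u v := H.Adj u v ∧ xor (s u) (s v) = x
  symm := ⟨fun u v h => ⟨h.1.symm, by rw [Bool.xor_comm, h.2]⟩⟩
  loopless := ⟨fun v h => H.loopless.irrefl v h.1⟩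

lemma parityPart_adj {H : SimpleGraph V} {s : V → Bool} {x : Bool} {u v : V} :
    (parityPart H s x).Adj u v ↔ H.Adj u v ∧ xor (s u) (s v) = x := Iff.rfl

variable [Fintype V] {H : SimpleGraph V} {s s' : V → Bool} {x x' : Bool} {M Z : Finset V}

lemma degree_parityPart_add_degree_parityPart_not (H : SimpleGraph V) (s : V → Bool) (x : Bool)
    (v : V) : (parityPart H s x).degree v + (parityPart H s !x).degree v = H.degree v := by
  refine degree_add_degree_of_disjoint ?_ ?_ v
  · exact SimpleGraph.disjoint_left.2 fun u w h h' => Bool.not_eq_self x |>.1 (h'.2.symm.trans h.2)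
  · ext u w
    simp only [SimpleGraph.sup_adj, parityPart, Bool.eq_not, ← and_or_left, em, and_true]

lemma degree_parityPart_le_add_card {v : V} (hM : ∀ u ∉ M, s u = s' u)
    (hv : xor (s v) x = xor (s' v) x') :
    (parityPart H s x).degree v ≤ (parityPart H s' x').degree v + #M := by
  simp only [← SimpleGraph.card_neighborFinset_eq_degree]
  refine (card_le_card fun u hu => ?_).trans (card_union_le _ M)
  rw [SimpleGraph.mem_neighborFinset] at hu
  rw [mem_union, SimpleGraph.mem_neighborFinset, or_iff_not_imp_right]
  intro huM
  refine ⟨hu.1, ?_⟩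
  rw [← hM u huM]
  have := hu.2
  revert this hv
  cases s v <;> cases s' v <;> cases s u <;> cases x <;> cases x' <;> simp

lemma sum_degree_parityPart_le (hM : ∀ u ∉ M, s u = s' u) (hMZ : M ⊆ Z) :
    ∑ v ∈ Z, (parityPart H s' x).degree v ≤
      ∑ v ∈ Z, (parityPart H s x).degree v + 2 * #M * Fintype.card V :=
  calc ∑ v ∈ Z, (parityPart H s' x).degree v
      ≤ ∑ v ∈ Z, ((parityPart H s x).degree v + #M + if v ∈ M then Fintype.card V else 0) := by
        refine sum_le_sum fun v _ => ?_
        split_ifs with hv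
        · exact (degree_le_card _ v).trans (Nat.le_add_left _ _)
        · exact degree_parityPart_le_add_card (fun u hu => (hM u hu).symm) (by rw [hM v hv])
    _ = ∑ v ∈ Z, (parityPart H s x).degree v + #Z * #M + #M * Fintype.card V := by
        rw [sum_add_distrib, sum_add_distrib, ← sum_filter, filter_mem_eq_inter,
          inter_eq_right.2 hMZ, sum_const, sum_const, smul_eq_mul, smul_eq_mul]
    _ ≤ ∑ v ∈ Z, (parityPart H s x).degree v + 2 * #M * Fintype.card V := by
        have := Nat.mul_le_mul_right #M (card_le_univ Z)
        linarith

/-- The vertices of `Z` most of whose edges do not have the parity `x`. -/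
noncomputable def minority (H : SimpleGraph V) (s : V → Bool) (x : Bool) (Z : Finset V) :
    Finset V :=
  {v ∈ Z | H.degree v < 2 * (parityPart H s !x).degree v}

lemma minority_subset : minority H s x Z ⊆ Z := filter_subset _ _

lemma card_minority_mul_le {δ : ℝ} (hdeg : ∀ v ∈ Z, δ ≤ H.degree v) :
    #(minority H s x Z) * δ ≤ 2 * ∑ v ∈ Z, ((parityPart H s !x).degree v : ℝ) :=
  calc #(minority H s x Z) * δ
      ≤ ∑ v ∈ minority H s x Z, 2 * ((parityPart H s !x).degree v : ℝ) := by
        rw [← nsmul_eq_mul]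
        refine card_nsmul_le_sum _ _ _ fun v hv => ?_
        obtain ⟨hvZ, hvbad⟩ := mem_filter.1 hv
        exact (hdeg v hvZ).trans (by exact_mod_cast hvbad.le)
    _ ≤ 2 * ∑ v ∈ Z, ((parityPart H s !x).degree v : ℝ) := by
        rw [← mul_sum]
        gcongr
        exact minority_subset

lemma degree_le_of_flip_minority (hflip : ∀ v, s' v = xor (s v) (decide (v ∈ minority H s x Z)))
    {v : V} (hv : v ∈ Z) :
    H.degree v ≤ 2 * ((parityPart H s' x).degree v + #(minority H s x Z)) := by
  have hM : ∀ u ∉ minority H s x Z, s u = s' u := fun u hu => by simp [hflip, hu]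
  have hsplit := degree_parityPart_add_degree_parityPart_not H s x v
  by_cases hvM : v ∈ minority H s x Z
  · have hvbad : H.degree v < 2 * (parityPart H s !x).degree v := (mem_filter.1 hvM).2
    have := degree_parityPart_le_add_card (H := H) (x := !x) (x' := x) (v := v) hM
      (by simp [hflip, hvM])
    omega
  · have hvgood : ¬ H.degree v < 2 * (parityPart H s !x).degree v :=
      fun h => hvM (mem_filter.2 ⟨hv, h⟩)
    have := degree_parityPart_le_add_card (H := H) (x := x) (x' := x) (v := v) hM
      (by rw [hM v hvM])
    omega

/-- Flip the vertices that see a majority of edges of the wrong parity. There are few of them, so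
the flips hardly disturb each other. -/
lemma exists_majority_recolouring [Nonempty V] {δ β : ℝ} (s : V → Bool) (hδ : 0 < δ)
    (hβ : 8 * β ≤ δ ^ 2)
    (hdeg : ∀ v ∈ Z, δ * Fintype.card V ≤ H.degree v)
    (hbad : ∑ v ∈ Z, ((parityPart H s !x).degree v : ℝ) ≤ β * (Fintype.card V : ℝ) ^ 2) :
    ∃ s' : V → Bool,
      (∀ v ∈ Z, δ / 4 * Fintype.card V ≤ (parityPart H s' x).degree v) ∧
      (#{v ∈ Z | s' v ≠ s v} : ℝ) ≤ δ / 4 * Fintype.card V ∧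
      ∑ v ∈ Z, ((parityPart H s' !x).degree v : ℝ) ≤
        (β + 4 * β / δ) * (Fintype.card V : ℝ) ^ 2 := by
  set n : ℝ := (Fintype.card V : ℝ)
  set M := minority H s x Z
  obtain ⟨s', hflip⟩ : ∃ s' : V → Bool, ∀ v, s' v = xor (s v) (decide (v ∈ M)) :=
    ⟨_, fun _ => rfl⟩
  have hM : (#M : ℝ) ≤ 2 * β / δ * n := by
    have h := (card_minority_mul_le (s := s) (x := x) hdeg).trans
      (mul_le_mul_of_nonneg_left hbad zero_le_two)
    rw [div_mul_eq_mul_div, le_div_iff₀ hδ]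
    have hn : 0 < n := Nat.cast_pos.2 Fintype.card_pos
    nlinarith
  have hM' : (#M : ℝ) ≤ δ / 4 * n := by
    refine hM.trans (mul_le_mul_of_nonneg_right ?_ (Nat.cast_nonneg _))
    rw [div_le_div_iff₀ hδ (by norm_num)]
    nlinarith
  refine ⟨s', fun v hv => ?_, ?_, ?_⟩
  · have h : (H.degree v : ℝ) ≤ 2 * ((parityPart H s' x).degree v + #M) := by
      exact_mod_cast degree_le_of_flip_minority hflip hv
    linarith [hdeg v hv]
  · refine le_trans ?_ hM'
    gcongr
    intro v hv
    by_contra hvM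
    exact (mem_filter.1 hv).2 (by simp [hflip, hvM])
  · have h : ∑ v ∈ Z, ((parityPart H s' !x).degree v : ℝ) ≤
        ∑ v ∈ Z, ((parityPart H s !x).degree v : ℝ) + 2 * #M * Fintype.card V := mod_cast
      sum_degree_parityPart_le (fun u hu => by simp [hflip, hu]) minority_subset
    calc ∑ v ∈ Z, ((parityPart H s' !x).degree v : ℝ)
        ≤ β * n ^ 2 + 2 * (2 * β / δ * n) * n := h.trans (by gcongr)
      _ = (β + 4 * β / δ) * n ^ 2 := by ring

end Parity

section InducedSubgraphs

variable {V : Type*}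

lemma card_interedges_comap {W : Type*} (H : SimpleGraph V) (e : W ↪ V) (X Y : Finset W) :
    #((H.comap e).interedges X Y) = #(H.interedges (X.map e) (Y.map e)) := by
  rw [← card_map (e.prodMap e)]
  congr 1
  ext ⟨a, b⟩
  simp only [mem_map, SimpleGraph.mem_interedges_iff, Prod.exists, SimpleGraph.comap_adj,
    Function.Embedding.coe_prodMap, Prod.map_apply, Prod.mk.injEq]
  constructor
  · rintro ⟨u, w, ⟨hu, hw, huw⟩, rfl, rfl⟩
    exact ⟨⟨u, hu, rfl⟩, ⟨w, hw, rfl⟩, huw⟩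
  · rintro ⟨⟨u, hu, rfl⟩, ⟨w, hw, rfl⟩, huw⟩
    exact ⟨u, w, ⟨hu, hw, huw⟩, rfl, rfl⟩

lemma map_subtype_compl (Z : Finset V) (X : Finset (Z : Set V)) :
    Xᶜ.map (Function.Embedding.subtype _) = Z \ X.map (Function.Embedding.subtype _) := by
  ext v
  by_cases hv : v ∈ Z <;> simp [hv]

lemma isSparseCut_induce_iff {H : SimpleGraph V} {Z : Finset V} {α : ℝ} {X : Finset (Z : Set V)} :
    IsSparseCut (H.induce (Z : Set V)) α X ↔
      (X.map (Function.Embedding.subtype _)).Nonempty ∧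
      (Z \ X.map (Function.Embedding.subtype _)).Nonempty ∧
      (#(H.interedges (X.map (Function.Embedding.subtype _))
        (Z \ X.map (Function.Embedding.subtype _))) : ℝ) ≤
        α * #(X.map (Function.Embedding.subtype _)) *
          #(Z \ X.map (Function.Embedding.subtype _)) := by
  simp only [← map_subtype_compl, ← card_interedges_comap, card_map, map_nonempty]
  unfold IsSparseCut
  congr!

lemma noSparseCuts_induce_iff {H : SimpleGraph V} {Z : Finset V} {α : ℝ} :
    NoSparseCuts (H.induce (Z : Set V)) α ↔
      ∀ X ⊆ Z, X.Nonempty → (Z \ X).Nonempty →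
        α * #X * #(Z \ X) < #(H.interedges X (Z \ X)) := by
  constructor
  · intro h X hXZ hX hY
    have hmap : (X.subtype (· ∈ (Z : Set V))).map (Function.Embedding.subtype _) = X := by
      rw [subtype_map]
      exact filter_true_of_mem hXZ
    by_contra hcut
    refine h _ ((isSparseCut_induce_iff (X := X.subtype (· ∈ (Z : Set V)))).2 ?_)
    rw [hmap]
    exact ⟨hX, hY, not_lt.1 hcut⟩
  · intro h X hX
    obtain ⟨hX, hY, hcut⟩ := isSparseCut_induce_iff.1 hX
    refine (h _ (fun v hv => ?_) hX hY).not_ge hcut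
    obtain ⟨w, -, rfl⟩ := mem_map.1 hv
    exact w.2

lemma exists_sum_degree_parityPart_le_of_isBipartite [Fintype V] {H : SimpleGraph V}
    {E : Set (Sym2 V)} (hE : (H.deleteEdges E).IsBipartite) :
    ∃ s : V → Bool, ∑ v, (parityPart H s false).degree v ≤ 2 * E.ncard := by
  obtain ⟨φ⟩ := hE
  refine ⟨fun v => decide (φ v = 0), ?_⟩
  rw [SimpleGraph.sum_degrees_eq_twice_card_edges, ← Set.ncard_coe_finset]
  gcongr
  · exact E.toFinite
  intro e
  induction e with
  | h u v =>
    rw [SimpleGraph.coe_edgeFinset, SimpleGraph.mem_edgeSet]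
    rintro ⟨huv, hφ⟩
    by_contra heE
    have hne : φ u ≠ φ v := φ.valid (SimpleGraph.deleteEdges_adj.2 ⟨huv, heE⟩)
    have hFin : ∀ a b : Fin 2, xor (decide (a = 0)) (decide (b = 0)) = false → a = b := by decide
    exact hne (hFin _ _ hφ)

lemma exists_sum_degree_parityPart_lt [Fintype V] {H : SimpleGraph V} {Z : Finset V} {m : ℝ}
    (hclosed : ∀ v ∈ Z, H.neighborSet v ⊆ Z)
    (hfar : ¬ IsFarFromBipartite (H.induce (Z : Set V)) m) :
    ∃ s : V → Bool, ∑ v ∈ Z, ((parityPart H s false).degree v : ℝ) < 2 * m := by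
  unfold IsFarFromBipartite at hfar
  push Not at hfar
  obtain ⟨E, -, hE, hEm⟩ := hfar
  obtain ⟨s, hs⟩ := exists_sum_degree_parityPart_le_of_isBipartite hE
  let s' : V → Bool := fun v => if h : v ∈ Z then s ⟨v, h⟩ else false
  have hinduce : parityPart (H.induce (Z : Set V)) s false =
      (parityPart H s' false).induce (Z : Set V) := by
    ext u v
    have hs' : ∀ w : (Z : Set V), s' w = s w := fun w => dif_pos w.2
    simp [parityPart, hs']
  have hsum : ∑ v ∈ Z, (parityPart H s' false).degree v =
      ∑ v, (parityPart (H.induce (Z : Set V)) s false).degree v := by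
    rw [← sum_coe_sort Z]
    refine sum_congr rfl fun v _ => ?_
    have hnbr : (parityPart H s' false).neighborSet v ⊆ (Z : Set V) :=
      fun u hu => hclosed v v.2 hu.1
    rw [← SimpleGraph.degree_induce_of_neighborSet_subset (v := v) hnbr]
    congr!
    exact hinduce.symm
  refine ⟨s', ?_⟩
  calc ∑ v ∈ Z, ((parityPart H s' false).degree v : ℝ) ≤ 2 * E.ncard := mod_cast hsum ▸ hs
    _ < 2 * m := by linarith

lemma sum_degree_parityPart_mem_le [Fintype V] {H : SimpleGraph V} {X Z : Finset V}
    (hXZ : X ⊆ Z) (hclosed : ∀ v ∈ Z, H.neighborSet v ⊆ Z) :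
    ∑ v ∈ Z, (parityPart H (fun v => decide (v ∈ X)) true).degree v ≤
      2 * #(H.interedges X (Z \ X)) := by
  have hX : ∀ v ∈ X, (parityPart H (fun v => decide (v ∈ X)) true).degree v ≤
      #(H.neighborFinset v ∩ (Z \ X)) := by
    intro v hv
    rw [← SimpleGraph.card_neighborFinset_eq_degree]
    gcongr
    intro u hu
    obtain ⟨hvu, huX⟩ := (SimpleGraph.mem_neighborFinset _ _ _).1 hu
    have huZ : u ∈ Z := hclosed v (hXZ hv) hvu
    simp_all
  have hY : ∀ v ∈ Z \ X, (parityPart H (fun v => decide (v ∈ X)) true).degree v ≤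
      #(H.neighborFinset v ∩ X) := by
    intro v hv
    rw [← SimpleGraph.card_neighborFinset_eq_degree]
    gcongr
    intro u hu
    obtain ⟨hvu, huX⟩ := (SimpleGraph.mem_neighborFinset _ _ _).1 hu
    simp_all
  calc _ = ∑ v ∈ X, (parityPart H (fun v => decide (v ∈ X)) true).degree v +
        ∑ v ∈ Z \ X, (parityPart H (fun v => decide (v ∈ X)) true).degree v := by
        rw [add_comm, sum_sdiff hXZ]
    _ ≤ #(H.interedges X (Z \ X)) + #(H.interedges (Z \ X) X) := by
        rw [card_interedges_eq_sum, card_interedges_eq_sum]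
        exact add_le_add (sum_le_sum hX) (sum_le_sum hY)
    _ = 2 * #(H.interedges X (Z \ X)) := by
        rw [two_mul, card_interedges_comm H (Z \ X)]

end InducedSubgraphs

/-- A division of the vertices into clusters, some of which are marked as bipartite and then have
two sides. The sides of the vertices in the other clusters play no role. -/
structure Labelling (V ι : Type*) where
  /-- The cluster of a vertex. -/
  cl : V → ι
  /-- The side of a vertex in its cluster. -/
  side : V → Bool
  /-- The clusters marked as bipartite. -/
  bip : Set ι

namespace Labelling

section Basic

variable {V ι : Type*}

/-- The edges that respect the labelling: they lie in a cluster and cross its sides if the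
cluster is marked as bipartite. -/
def kept (S : Labelling V ι) (G : SimpleGraph V) : SimpleGraph V where
  Adj u v := G.Adj u v ∧ S.cl u = S.cl v ∧ (S.cl u ∈ S.bip → S.side u ≠ S.side v)
  symm := ⟨fun _ _ h => ⟨h.1.symm, h.2.1.symm, fun hb => (h.2.2 (h.2.1 ▸ hb)).symm⟩⟩
  loopless := ⟨fun v h => G.loopless.irrefl v h.1⟩

/-- The edges that do not respect the labelling. -/
def lost (S : Labelling V ι) (G : SimpleGraph V) : SimpleGraph V := G \ S.kept G

variable {S : Labelling V ι} {G : SimpleGraph V}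

lemma kept_le : S.kept G ≤ G := fun _ _ h => h.1

lemma lost_le : S.lost G ≤ G := sdiff_le

variable [Fintype V]

/-- The vertex set of a cluster. -/
noncomputable def cluster (S : Labelling V ι) (i : ι) : Finset V := {v | S.cl v = i}

/-- The indices of the non-empty clusters. -/
noncomputable def indices (S : Labelling V ι) : Finset ι := univ.image S.cl

/-- The number of clusters, those marked as bipartite counting twice. -/
noncomputable def potential (S : Labelling V ι) : ℕ :=
  #S.indices + #{i ∈ S.indices | i ∈ S.bip}

/-- Few edges are lost, and all vertices keep linear degree. -/
structure IsGood (S : Labelling V ι) (G : SimpleGraph V) (η δ : ℝ) : Prop where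
  sum_degree_lost_le : ∑ v, ((S.lost G).degree v : ℝ) ≤ η * (Fintype.card V : ℝ) ^ 2
  le_degree_kept : ∀ v, δ * Fintype.card V ≤ (S.kept G).degree v

/-- No cluster has a `ζ`-sparse cut, and the clusters not marked as bipartite are far from being
bipartite. -/
def IsTerminal (S : Labelling V ι) (G : SimpleGraph V) (ζ γ : ℝ) : Prop :=
  ∀ i ∈ S.indices, NoSparseCuts ((S.kept G).induce (S.cluster i : Set V)) ζ ∧
    (i ∈ S.bip ∨ IsFarFromBipartite ((S.kept G).induce (S.cluster i : Set V))
      (γ * (Fintype.card V : ℝ) ^ 2))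

lemma mem_cluster {i : ι} {v : V} : v ∈ S.cluster i ↔ S.cl v = i := by
  simp [cluster]

lemma mem_indices {i : ι} : i ∈ S.indices ↔ ∃ v, S.cl v = i := by
  simp [indices]

lemma cl_mem_indices (v : V) : S.cl v ∈ S.indices := mem_indices.2 ⟨v, rfl⟩

lemma potential_le_two_mul_card_indices : S.potential ≤ 2 * #S.indices := by
  have := card_filter_le S.indices (· ∈ S.bip)
  unfold potential
  omega

lemma degree_kept_add_degree_lost (S : Labelling V ι) (G : SimpleGraph V) (v : V) :
    (S.kept G).degree v + (S.lost G).degree v = G.degree v :=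
  degree_add_degree_of_disjoint disjoint_sdiff_self_right (sup_sdiff_cancel_right kept_le) v

lemma neighborSet_kept_subset_cluster {i : ι} {v : V} (hv : v ∈ S.cluster i) :
    (S.kept G).neighborSet v ⊆ S.cluster i := by
  intro u hvu
  rw [mem_coe, mem_cluster, ← hvu.2.1, mem_cluster.1 hv]

lemma degree_kept_le_card_cluster (S : Labelling V ι) (G : SimpleGraph V) (v : V) :
    (S.kept G).degree v ≤ #(S.cluster (S.cl v)) := by
  rw [← SimpleGraph.card_neighborFinset_eq_degree]
  refine card_le_card fun u hu => ?_
  rw [SimpleGraph.mem_neighborFinset] at hu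
  exact neighborSet_kept_subset_cluster (mem_cluster.2 rfl) hu

namespace IsGood

variable {η η' δ δ' : ℝ}

lemma mono (hS : S.IsGood G η δ) (hη : η ≤ η') (hδ : δ' ≤ δ) : S.IsGood G η' δ' :=
  ⟨hS.sum_degree_lost_le.trans (by gcongr), fun v => le_trans (by gcongr) (hS.le_degree_kept v)⟩

lemma nonneg [Nonempty V] (hS : S.IsGood G η δ) : 0 ≤ η := by
  have h : 0 ≤ η * (Fintype.card V : ℝ) ^ 2 :=
    (sum_nonneg fun v _ => Nat.cast_nonneg _).trans hS.sum_degree_lost_le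
  exact nonneg_of_mul_nonneg_left h (pow_pos (Nat.cast_pos.2 Fintype.card_pos) 2)

lemma le_one [Nonempty V] (hS : S.IsGood G η δ) : δ ≤ 1 := by
  obtain ⟨v⟩ := ‹Nonempty V›
  have hn : (0 : ℝ) < Fintype.card V := Nat.cast_pos.2 (Fintype.card_pos_iff.2 ⟨v⟩)
  refine le_of_mul_le_mul_right ((hS.le_degree_kept v).trans ?_) hn
  rw [one_mul]
  exact_mod_cast degree_le_card _ v

lemma le_card_cluster (hS : S.IsGood G η δ) {i : ι} (hi : i ∈ S.indices) :
    δ * Fintype.card V ≤ #(S.cluster i) := by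
  obtain ⟨v, rfl⟩ := mem_indices.1 hi
  exact (hS.le_degree_kept v).trans (by exact_mod_cast S.degree_kept_le_card_cluster G v)

/-- A cluster of size much less than `d` would lose almost all its edges. -/
lemma sub_le_card_cluster [Nonempty V] {c : ℝ} {d : ℕ} (hS : S.IsGood G η δ) (hδ : 0 < δ)
    (hG : ∀ v, G.degree v = d) (hd : c * Fintype.card V ≤ d) {i : ι} (hi : i ∈ S.indices) :
    (c - η / δ) * Fintype.card V ≤ #(S.cluster i) := by
  set n : ℝ := (Fintype.card V : ℝ)
  have hn : 0 < n := Nat.cast_pos.2 Fintype.card_pos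
  have hη := hS.nonneg
  have hlost : #(S.cluster i) * ((d : ℝ) - #(S.cluster i)) ≤ η * n ^ 2 :=
    calc #(S.cluster i) * ((d : ℝ) - #(S.cluster i))
        ≤ ∑ v ∈ S.cluster i, ((S.lost G).degree v : ℝ) := by
          rw [← nsmul_eq_mul]
          refine card_nsmul_le_sum _ _ _ fun v hv => ?_
          have hdeg := S.degree_kept_add_degree_lost G v
          have hkept := S.degree_kept_le_card_cluster G v
          rw [mem_cluster.1 hv] at hkept
          rw [hG] at hdeg
          rw [sub_le_iff_le_add]
          exact_mod_cast (by omega : d ≤ (S.lost G).degree v + #(S.cluster i))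
      _ ≤ ∑ v, ((S.lost G).degree v : ℝ) :=
          sum_le_sum_of_subset_of_nonneg (subset_univ _) fun _ _ _ => Nat.cast_nonneg _
      _ ≤ η * n ^ 2 := hS.sum_degree_lost_le
  by_contra! hsmall
  have hgap : η / δ * n < d - #(S.cluster i) := by linarith
  have hcontra : η * n ^ 2 < #(S.cluster i) * ((d : ℝ) - #(S.cluster i)) :=
    calc η * n ^ 2 = δ * n * (η / δ * n) := by field_simp
      _ < δ * n * (d - #(S.cluster i)) := by gcongr
      _ ≤ #(S.cluster i) * (d - #(S.cluster i)) := by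
          gcongr
          · exact le_trans (by positivity) hgap.le
          · exact hS.le_card_cluster hi
  exact hcontra.not_ge hlost

lemma card_indices_le [Nonempty V] {c : ℝ} {d R : ℕ} (hS : S.IsGood G η δ) (hδ : 0 < δ)
    (hc : 0 < c) (hG : ∀ v, G.degree v = d) (hd : c * Fintype.card V ≤ d) (hR : 1 / c ≤ R)
    (hη : η ≤ c * δ / (2 * (R + 1))) : #S.indices ≤ R := by
  have hn : (0 : ℝ) < Fintype.card V := Nat.cast_pos.2 Fintype.card_pos
  have hsum : (#S.indices : ℝ) * ((c - η / δ) * Fintype.card V) ≤ Fintype.card V :=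
    calc (#S.indices : ℝ) * ((c - η / δ) * Fintype.card V)
        ≤ ∑ i ∈ S.indices, (#(S.cluster i) : ℝ) := by
          rw [← nsmul_eq_mul]
          exact card_nsmul_le_sum _ _ _ fun i hi => hS.sub_le_card_cluster hδ hG hd hi
      _ = Fintype.card V := by
          exact_mod_cast (card_eq_sum_card_image S.cl univ).symm.trans card_univ
  have hle : (#S.indices : ℝ) * (c - η / δ) ≤ 1 := by
    refine le_of_mul_le_mul_right ?_ hn
    linarith
  by_contra! hlt
  have hR1 : (R + 1 : ℝ) ≤ #S.indices := by exact_mod_cast hlt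
  have hηδ : (R + 1) * (η / δ) < c :=
    calc (R + 1) * (η / δ) ≤ (R + 1) * (c * δ / (2 * (R + 1)) / δ) := by gcongr
      _ = c / 2 := by field_simp
      _ < c := half_lt_self hc
  have hpos : 0 ≤ η / δ := div_nonneg hS.nonneg hδ.le
  rw [div_le_iff₀ hc] at hR
  nlinarith

end IsGood

end Basic

section Refinement

variable {V ι : Type*} [Fintype V] {S : Labelling V ι} {G : SimpleGraph V} {η δ : ℝ}

lemma IsGood.of_parityPart {S' : Labelling V ι} {β : ℝ} (hS : S.IsGood G η δ) (hδ : 0 < δ)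
    {x : Bool} {s : V → Bool} {Z : Finset V}
    (hkept : ∀ u v, (S'.kept G).Adj u v ↔ (S.kept G).Adj u v ∧ (u ∈ Z → xor (s u) (s v) = x))
    (hgood : ∀ v ∈ Z, δ / 4 * Fintype.card V ≤ (parityPart (S.kept G) s x).degree v)
    (hbad : ∑ v ∈ Z, ((parityPart (S.kept G) s !x).degree v : ℝ) ≤
      β * (Fintype.card V : ℝ) ^ 2) :
    S'.IsGood G (η + β) (δ / 4) := by
  have hin : ∀ v ∈ Z, (S'.kept G).degree v = (parityPart (S.kept G) s x).degree v := by
    intro v hv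
    simp only [← SimpleGraph.card_neighborFinset_eq_degree]
    congr 1
    ext u
    simp [hkept, hv, parityPart_adj]
  have hout : ∀ v ∉ Z, (S'.kept G).degree v = (S.kept G).degree v := by
    intro v hv
    simp only [← SimpleGraph.card_neighborFinset_eq_degree]
    congr 1
    ext u
    simp [hkept, hv]
  have hlost : ∀ v, (S'.lost G).degree v = (S.lost G).degree v +
      if v ∈ Z then (parityPart (S.kept G) s !x).degree v else 0 := by
    intro v
    have h := S.degree_kept_add_degree_lost G v
    have h' := S'.degree_kept_add_degree_lost G v
    have hsplit := degree_parityPart_add_degree_parityPart_not (S.kept G) s x v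
    split_ifs with hv
    · rw [hin v hv] at h'
      omega
    · rw [hout v hv] at h'
      omega
  constructor
  · calc ∑ v, ((S'.lost G).degree v : ℝ)
        = ∑ v, ((S.lost G).degree v : ℝ) +
            ∑ v ∈ Z, ((parityPart (S.kept G) s !x).degree v : ℝ) := by
          have h := sum_congr rfl fun v (_ : v ∈ univ) => hlost v
          rw [sum_add_distrib, ← sum_filter, filter_mem_eq_inter, univ_inter] at h
          exact_mod_cast h
      _ ≤ (η + β) * (Fintype.card V : ℝ) ^ 2 := by
          rw [add_mul]
          exact add_le_add hS.sum_degree_lost_le hbad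
  · intro v
    by_cases hv : v ∈ Z
    · rw [hin v hv]
      exact hgood v hv
    · rw [hout v hv]
      exact le_trans (by gcongr; linarith) (hS.le_degree_kept v)

lemma IsGood.exists_recolouring [Nonempty V] {β : ℝ} (hS : S.IsGood G η δ) (hδ : 0 < δ)
    (hβ : 16 * β ≤ δ ^ 2) {x : Bool} {s : V → Bool} {Z : Finset V}
    (hbad : ∑ v ∈ Z, ((parityPart (S.kept G) s !x).degree v : ℝ) ≤
      2 * (β * (Fintype.card V : ℝ) ^ 2)) :
    ∃ s' : V → Bool, (#{v ∈ Z | s' v ≠ s v} : ℝ) ≤ δ / 4 * Fintype.card V ∧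
      ∀ S' : Labelling V ι, (∀ u v, (S'.kept G).Adj u v ↔
        (S.kept G).Adj u v ∧ (u ∈ Z → xor (s' u) (s' v) = x)) →
        S'.IsGood G (η + (2 * β + 8 * β / δ)) (δ / 4) := by
  obtain ⟨s', hgood, hfew, hbad'⟩ := exists_majority_recolouring (β := 2 * β) s hδ (by linarith)
    (fun v _ => hS.le_degree_kept v) (hbad.trans_eq (by ring))
  exact ⟨s', hfew, fun S' hkept =>
    hS.of_parityPart hδ hkept hgood (hbad'.trans_eq (by ring))⟩

/-- The labelling in which the vertices of colour `false` of the cluster `i` form a new cluster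
`i'`, marked as bipartite if `i` is. -/
noncomputable def split (S : Labelling V ι) (i i' : ι) (s : V → Bool) : Labelling V ι where
  cl v := if S.cl v = i ∧ s v = false then i' else S.cl v
  side := S.side
  bip := {j | (if j = i' then i else j) ∈ S.bip}

/-- The labelling in which the cluster `i` is marked as bipartite, with the colour classes as
sides. -/
noncomputable def mark (S : Labelling V ι) (i : ι) (s : V → Bool) : Labelling V ι where
  cl := S.cl
  side v := if S.cl v = i then s v else S.side v
  bip := insert i S.bip

lemma cl_ne_of_notMem_indices {i : ι} (hi : i ∉ S.indices) (v : V) : S.cl v ≠ i :=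
  fun h => hi (mem_indices.2 ⟨v, h⟩)

lemma cl_split_mem_bip {i i' : ι} (hi' : i' ∉ S.indices) (s : V → Bool) (v : V) :
    (S.split i i' s).cl v ∈ (S.split i i' s).bip ↔ S.cl v ∈ S.bip := by
  have hv := cl_ne_of_notMem_indices hi' v
  simp only [split, Set.mem_ofPred_eq]
  by_cases h : S.cl v = i ∧ s v = false
  · rw [if_pos h, if_pos rfl, h.1]
  · rw [if_neg h, if_neg hv]

lemma cl_split_eq_iff {i i' : ι} (hi' : i' ∉ S.indices) (s : V → Bool) (u v : V) :
    (S.split i i' s).cl u = (S.split i i' s).cl v ↔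
      S.cl u = S.cl v ∧ (S.cl u = i → xor (s u) (s v) = false) := by
  have hu := cl_ne_of_notMem_indices hi' u
  have hv := cl_ne_of_notMem_indices hi' v
  simp only [split]
  cases s u <;> cases s v <;> grind

lemma kept_split_adj {i i' : ι} (hi' : i' ∉ S.indices) (s : V → Bool) (u v : V) :
    ((S.split i i' s).kept G).Adj u v ↔
      (S.kept G).Adj u v ∧ (u ∈ S.cluster i → xor (s u) (s v) = false) := by
  simp only [kept, cl_split_mem_bip hi', cl_split_eq_iff hi', mem_cluster]
  simp only [split]
  tauto

lemma kept_mark_adj {i : ι} (hi : i ∉ S.bip) (s : V → Bool) (u v : V) :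
    ((S.mark i s).kept G).Adj u v ↔
      (S.kept G).Adj u v ∧ (u ∈ S.cluster i → xor (s u) (s v) = true) := by
  simp only [kept, mark, mem_cluster, Set.mem_insert_iff]
  cases s u <;> cases s v <;> grind

lemma potential_lt_potential_split {i i' : ι} (hi' : i' ∉ S.indices) {s : V → Bool}
    (hs : ∀ b, ∃ v ∈ S.cluster i, s v = b) : S.potential < (S.split i i' s).potential := by
  have hsub : insert i' S.indices ⊆ (S.split i i' s).indices := by
    refine insert_subset ?_ fun j hj => ?_
    · obtain ⟨v, hv, hsv⟩ := hs false
      exact mem_indices.2 ⟨v, if_pos ⟨mem_cluster.1 hv, hsv⟩⟩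
    · obtain ⟨w, rfl⟩ := mem_indices.1 hj
      by_cases hw : S.cl w = i
      · obtain ⟨v, hv, hsv⟩ := hs true
        exact mem_indices.2 ⟨v, (if_neg (by simp [hsv])).trans ((mem_cluster.1 hv).trans hw.symm)⟩
      · exact mem_indices.2 ⟨w, if_neg fun h => hw h.1⟩
  have hcard : #S.indices < #(S.split i i' s).indices :=
    card_lt_card ((ssubset_insert hi').trans_subset hsub)
  refine add_lt_add_of_lt_of_le hcard (card_le_card fun j hj => ?_)
  obtain ⟨hj, hjb⟩ := mem_filter.1 hj
  refine mem_filter.2 ⟨hsub (mem_insert_of_mem hj), ?_⟩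
  have hne : j ≠ i' := fun h => hi' (h ▸ hj)
  simpa only [split, Set.mem_ofPred_eq, if_neg hne] using hjb

lemma potential_lt_potential_mark {i : ι} (hi : i ∈ S.indices) (hib : i ∉ S.bip) (s : V → Bool) :
    S.potential < (S.mark i s).potential := by
  refine Nat.add_lt_add_left (card_lt_card (ssubset_iff_of_subset ?_ |>.2 ⟨i, ?_, ?_⟩)) _
  · exact monotone_filter_right _ fun j _ hj => Set.mem_insert_of_mem _ hj
  · exact mem_filter.2 ⟨hi, Set.mem_insert _ _⟩
  · exact fun h => hib (mem_filter.1 h).2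

lemma IsGood.lt_card_of_card_interedges_le [Nonempty V] {β : ℝ} (hS : S.IsGood G η δ) (hδ : 0 < δ)
    (hβ₀ : 0 ≤ β) (hβ : 16 * β ≤ δ ^ 2) {i : ι} {A B : Finset V} (hA : A.Nonempty)
    (hAB : A ∪ B = S.cluster i) (hcut : (#((S.kept G).interedges A B) : ℝ) ≤ β * #A * #B) :
    δ / 4 * Fintype.card V < #A := by
  have h := sub_le_card_of_card_interedges_le (B := B) (δ := δ * Fintype.card V)
    (α := β * Fintype.card V) hA (fun v hv => ?_) (fun v _ => hS.le_degree_kept v) ?_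
  · have hn : (0 : ℝ) < Fintype.card V := Nat.cast_pos.2 Fintype.card_pos
    have : β < 3 / 4 * δ := by nlinarith [hS.le_one]
    nlinarith
  · rw [hAB, ← coe_subset, SimpleGraph.coe_neighborFinset]
    exact neighborSet_kept_subset_cluster (hAB ▸ mem_union_left _ hv)
  · calc (#((S.kept G).interedges A B) : ℝ) ≤ β * #A * Fintype.card V :=
          hcut.trans (by gcongr; exact card_le_univ B)
      _ = β * Fintype.card V * #A := by ring

/-- By the minimum degree both sides of a sparse cut are large, so both colours survive. -/
lemma IsGood.exists_split [Nonempty V] {β : ℝ} (hS : S.IsGood G η δ) (hδ : 0 < δ)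
    (hβ₀ : 0 ≤ β) (hβ : 16 * β ≤ δ ^ 2) {i i' : ι} (hi' : i' ∉ S.indices)
    (hcut : ¬ NoSparseCuts ((S.kept G).induce (S.cluster i : Set V)) β) :
    ∃ S' : Labelling V ι, S'.IsGood G (η + (2 * β + 8 * β / δ)) (δ / 4) ∧
      S.potential < S'.potential := by
  rw [noSparseCuts_induce_iff] at hcut
  push Not at hcut
  obtain ⟨X, hXZ, hX, hY, hXY⟩ := hcut
  have hbad : ∑ v ∈ S.cluster i,
      ((parityPart (S.kept G) (fun v => decide (v ∈ X)) !false).degree v : ℝ) ≤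
        2 * (β * (Fintype.card V : ℝ) ^ 2) :=
    calc _ ≤ 2 * (#((S.kept G).interedges X (S.cluster i \ X)) : ℝ) := by
          exact_mod_cast sum_degree_parityPart_mem_le hXZ fun v => neighborSet_kept_subset_cluster
      _ ≤ 2 * (β * Fintype.card V * Fintype.card V) := by
          refine mul_le_mul_of_nonneg_left (hXY.trans ?_) zero_le_two
          gcongr <;> exact card_le_univ _
      _ = 2 * (β * (Fintype.card V : ℝ) ^ 2) := by ring
  obtain ⟨s, hfew, hgood⟩ := hS.exists_recolouring hδ hβ hbad
  refine ⟨S.split i i' s, hgood _ (kept_split_adj hi' s), potential_lt_potential_split hi' ?_⟩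
  have hcolour : ∀ (A : Finset V) (b : Bool), A ⊆ S.cluster i → (∀ v ∈ A, decide (v ∈ X) = b) →
      δ / 4 * Fintype.card V < #A → ∃ v ∈ S.cluster i, s v = b := by
    intro A b hAZ hAb hA
    by_contra! hs
    refine (hA.trans_le ?_).not_ge hfew
    gcongr
    exact fun v hv => mem_filter.2 ⟨hAZ hv, hAb v hv ▸ hs v (hAZ hv)⟩
  rintro (_ | _)
  · refine hcolour (S.cluster i \ X) _ sdiff_subset (fun v hv => by simp [(mem_sdiff.1 hv).2])
      (hS.lt_card_of_card_interedges_le hδ hβ₀ hβ hY (sdiff_union_of_subset hXZ) ?_)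
    rw [card_interedges_comm]
    exact hXY.trans_eq (by ring)
  · exact hcolour X _ hXZ (fun v hv => by simp [hv])
      (hS.lt_card_of_card_interedges_le hδ hβ₀ hβ hX (union_sdiff_of_subset hXZ) hXY)

lemma IsGood.exists_mark [Nonempty V] {β : ℝ} (hS : S.IsGood G η δ) (hδ : 0 < δ)
    (hβ : 16 * β ≤ δ ^ 2) {i : ι} (hi : i ∈ S.indices) (hib : i ∉ S.bip)
    (hfar : ¬ IsFarFromBipartite ((S.kept G).induce (S.cluster i : Set V))
      (β * (Fintype.card V : ℝ) ^ 2)) :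
    ∃ S' : Labelling V ι, S'.IsGood G (η + (2 * β + 8 * β / δ)) (δ / 4) ∧
      S.potential < S'.potential := by
  obtain ⟨s, hs⟩ :=
    exists_sum_degree_parityPart_lt (fun v hv => neighborSet_kept_subset_cluster hv) hfar
  obtain ⟨s', -, hgood⟩ := hS.exists_recolouring (x := true) hδ hβ (by exact_mod_cast hs.le)
  exact ⟨S.mark i s', hgood _ (kept_mark_adj hib s'), potential_lt_potential_mark hi hib s'⟩

lemma IsGood.exists_refinement_of_not_isTerminal [Nonempty V] {ζ γ β : ℝ} (hS : S.IsGood G η δ)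
    (hδ : 0 < δ) (hζ₀ : 0 ≤ ζ) (hζ : ζ ≤ β) (hγ : γ ≤ β) (hβ : 16 * β ≤ δ ^ 2)
    (hnew : ∃ i, i ∉ S.indices) (hterm : ¬ S.IsTerminal G ζ γ) :
    ∃ S' : Labelling V ι, S'.IsGood G (η + (2 * β + 8 * β / δ)) (δ / 4) ∧
      S.potential < S'.potential := by
  have hmono : ∀ x ≤ β, η + (2 * x + 8 * x / δ) ≤ η + (2 * β + 8 * β / δ) :=
    fun x hx => by gcongr
  simp only [IsTerminal, not_forall] at hterm
  obtain ⟨i, hi, hfail⟩ := hterm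
  by_cases hcut : NoSparseCuts ((S.kept G).induce (S.cluster i : Set V)) ζ
  · obtain ⟨hib, hfar⟩ := not_or.1 fun h => hfail ⟨hcut, h⟩
    obtain ⟨S', hS', hpot⟩ := hS.exists_mark hδ (by linarith) hi hib hfar
    exact ⟨S', hS'.mono (hmono γ hγ) le_rfl, hpot⟩
  · obtain ⟨i', hi'⟩ := hnew
    obtain ⟨S', hS', hpot⟩ := hS.exists_split hδ hζ₀ (by linarith) hi' hcut
    exact ⟨S', hS'.mono (hmono ζ hζ) le_rfl, hpot⟩

end Refinement

section Termination

/-- A scale is chosen for each of the `j` refinements that may still be needed, the last one first,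
and `η₀` is the smallest `η` among these scales. -/
lemma exists_isTerminal (rel : ℝ → ℝ → ℝ → Prop)
    (hrel : ∀ e > 0, ∃ η ζ γ : ℝ, 0 < η ∧ 0 < ζ ∧ 0 < γ ∧ η ≤ e ∧ ζ ≤ e ∧ γ ≤ e ∧ rel η ζ γ)
    {c δ : ℝ} (hc : 0 < c) (hδ : 0 < δ) {R : ℕ} (hR : 1 / c ≤ R) (j : ℕ) :
    ∃ η₀ > 0, ∀ (V : Type u) [Fintype V] [Nonempty V] (G : SimpleGraph V) (d : ℕ)
      (S : Labelling V (Fin (R + 1))), (∀ v, G.degree v = d) → c * Fintype.card V ≤ d →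
      S.IsGood G η₀ (4 ^ j * δ) → 2 * R < S.potential + j →
      ∃ (η ζ γ : ℝ) (S' : Labelling V (Fin (R + 1))), η₀ ≤ η ∧ 0 < ζ ∧ 0 < γ ∧ rel η ζ γ ∧
        S'.IsGood G η δ ∧ #S'.indices ≤ R ∧ S'.IsTerminal G (4 * ζ) (2 * γ) := by
  induction j with
  | zero =>
    refine ⟨c * δ / (2 * (R + 1)), by positivity, fun V _ _ G d S hG hd hS hpot => ?_⟩
    have := (hS.mono le_rfl (by simp)).card_indices_le hδ hc hG hd hR le_rfl
    have := S.potential_le_two_mul_card_indices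
    omega
  | succ j ih =>
    obtain ⟨η₁, hη₁, ih⟩ := ih
    set e : ℝ := min (η₁ / (9 + 32 / δ)) (min (δ ^ 2 / 64) (c * δ / (2 * (R + 1))))
    have he : 0 < e := by positivity
    have he₁ : e * (9 + 32 / δ) ≤ η₁ := (le_div_iff₀ (by positivity)).1 (min_le_left _ _)
    have he₂ : e ≤ δ ^ 2 / 64 := (min_le_right _ _).trans (min_le_left _ _)
    have he₃ : e ≤ c * δ / (2 * (R + 1)) := (min_le_right _ _).trans (min_le_right _ _)
    obtain ⟨η, ζ, γ, hη, hζ, hγ, hηe, hζe, hγe, hr⟩ := hrel e he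
    refine ⟨η, hη, fun V _ _ G d S hG hd hS hpot => ?_⟩
    set δ' : ℝ := 4 ^ (j + 1) * δ
    have hδδ' : δ ≤ δ' := le_mul_of_one_le_left hδ.le (one_le_pow₀ (by norm_num))
    have hind : #S.indices ≤ R :=
      (hS.mono le_rfl hδδ').card_indices_le hδ hc hG hd hR (hηe.trans he₃)
    by_cases hterm : S.IsTerminal G (4 * ζ) (2 * γ)
    · exact ⟨η, ζ, γ, S, le_rfl, hζ, hγ, hr, hS.mono le_rfl hδδ', hind, hterm⟩
    have hη₁' : η + (2 * (4 * e) + 8 * (4 * e) / δ') ≤ η₁ :=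
      calc η + (2 * (4 * e) + 8 * (4 * e) / δ') ≤ e + (2 * (4 * e) + 8 * (4 * e) / δ) := by gcongr
        _ = e * (9 + 32 / δ) := by ring
        _ ≤ η₁ := he₁
    obtain ⟨i, -, hi⟩ := exists_mem_notMem_of_card_lt_card (s := S.indices) (t := univ)
      (by rw [card_univ, Fintype.card_fin]; omega)
    obtain ⟨S', hS', hpot'⟩ := hS.exists_refinement_of_not_isTerminal (β := 4 * e)
      (hδ.trans_le hδδ') (by positivity) (by linarith) (by linarith) (by nlinarith) ⟨i, hi⟩ hterm
    obtain ⟨η', ζ', γ', S'', hη', hS''⟩ := ih V G d S' hG hd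
      (hS'.mono hη₁' (by simp only [δ', pow_succ]; linarith)) (by omega)
    refine ⟨η', ζ', γ', S'', le_trans ?_ hη', hS''⟩
    exact le_of_add_le_of_nonneg_left hη₁' (by positivity)

end Termination

end Labelling

section Packing

variable {V W : Type*} {G : SimpleGraph V} {H : SimpleGraph W} {U U' : Set V}

/-- The set `U` is covered exactly by vertex-disjoint copies of `H` in `G`. In contrast to perfect
packings of `G.induce U`, such coverings by copies in `G` itself can be merged directly. -/
def HasPackingOn (H : SimpleGraph W) (G : SimpleGraph V) (U : Set V) : Prop :=
  ∃ 𝒦 : Set (SimpleGraph.Copy H G),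
    𝒦.PairwiseDisjoint (fun f => Set.range f) ∧ ⋃ f ∈ 𝒦, Set.range f = U

lemma hasPackingOn_empty : HasPackingOn H G ∅ := ⟨∅, by simp, by simp⟩

lemma hasPackingOn_range (f : SimpleGraph.Copy H G) : HasPackingOn H G (Set.range f) :=
  ⟨{f}, by simp, by simp⟩

lemma HasPackingOn.union (hU : HasPackingOn H G U) (hU' : HasPackingOn H G U')
    (hUU' : Disjoint U U') : HasPackingOn H G (U ∪ U') := by
  obtain ⟨𝒦, h𝒦, rfl⟩ := hU
  obtain ⟨𝒦', h𝒦', rfl⟩ := hU'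
  refine ⟨𝒦 ∪ 𝒦', Set.pairwiseDisjoint_union.2 ⟨h𝒦, h𝒦', fun f hf f' hf' _ => ?_⟩,
    Set.biUnion_union _ _ _⟩
  exact hUU'.mono (Set.subset_biUnion_of_mem (u := fun f : SimpleGraph.Copy H G => Set.range f) hf)
    (Set.subset_biUnion_of_mem (u := fun f : SimpleGraph.Copy H G => Set.range f) hf')

lemma HasPackingOn.hasPerfectPacking_induce (hU : HasPackingOn H G U) :
    HasPerfectPacking H (G.induce U) := by
  obtain ⟨𝒦, h𝒦, rfl⟩ := hU
  set U := ⋃ f ∈ 𝒦, Set.range f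
  let incl : SimpleGraph.Copy (G.induce U) G := SimpleGraph.Copy.induce G U
  have hverts (f : SimpleGraph.Copy H (G.induce U)) : f.toSubgraph.verts = Set.range f :=
    Set.image_univ
  refine ⟨SimpleGraph.Copy.toSubgraph '' {f | incl.comp f ∈ 𝒦}, ?_, ?_, ?_⟩
  · rintro _ ⟨f, -, rfl⟩
    exact ⟨f.isoToSubgraph.symm⟩
  · rintro _ ⟨f, hf, rfl⟩ _ ⟨f', hf', rfl⟩ hne
    have hcomp : incl.comp f ≠ incl.comp f' := fun h => hne <| congrArg _ <|
      SimpleGraph.Copy.ext fun w => Subtype.ext (DFunLike.congr_fun h w)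
    simp only [Function.onFun, hverts]
    rw [Set.disjoint_left]
    rintro _ ⟨w, rfl⟩ ⟨w', hw'⟩
    exact Set.disjoint_left.1 (h𝒦 hf hf' hcomp) ⟨w, rfl⟩ ⟨w', congrArg Subtype.val hw'⟩
  · refine Set.eq_univ_of_forall fun ⟨x, hx⟩ => ?_
    obtain ⟨f, hf, w, rfl⟩ := Set.mem_iUnion₂.1 hx
    have hfU (w : W) : f w ∈ U := Set.mem_biUnion hf ⟨w, rfl⟩
    let f' : SimpleGraph.Copy H (G.induce U) :=
      ⟨⟨fun w => ⟨f w, hfU w⟩, fun h => f.toHom.map_adj h⟩,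
        fun _ _ h => f.injective (congrArg Subtype.val h)⟩
    exact Set.mem_biUnion ⟨f', hf, rfl⟩ ((hverts f').symm ▸ ⟨w, rfl⟩)

lemma hasPackingOn_of_isCompleteBetween {t : ℕ} {A B : Finset V} (hA : #A = t) (hB : #B = t)
    (h : G.IsCompleteBetween A B) :
    HasPackingOn (completeBipartiteGraph (Fin t) (Fin t)) G (A ∪ B) := by
  let eA := (A.equivFinOfCardEq hA).symm
  let eB := (B.equivFinOfCardEq hB).symm
  let f : Fin t ⊕ Fin t → V := Sum.elim (fun i => eA i) (fun i => eB i)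
  have hf : f.Injective := (Subtype.val_injective.comp eA.injective).sumElim
    (Subtype.val_injective.comp eB.injective) fun i j => (h (eA i).2 (eB j).2).ne
  have hadj : ∀ {x y}, (completeBipartiteGraph (Fin t) (Fin t)).Adj x y → G.Adj (f x) (f y) := by
    rintro (i | i) (j | j) hij
    · simp at hij
    · exact h (eA i).2 (eB j).2
    · exact (h (eA j).2 (eB i).2).symm
    · simp at hij
  have hrange_val {C : Finset V} (e : Fin t ≃ C) : Set.range (fun i => (e i : V)) = C := by
    exact (e.surjective.range_comp (Subtype.val : C → V)).trans Subtype.range_coe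
  have hrange : Set.range f = (A : Set V) ∪ B := by
    rw [Set.Sum.elim_range, hrange_val, hrange_val]
  rw [← hrange]
  exact hasPackingOn_range ⟨⟨f, hadj⟩, hf⟩

end Packing

section CommonNeighbours

variable {V : Type*} [Fintype V] {H : SimpleGraph V}

/-- Double counting of the edges from `B` to the complement of `F`. -/
lemma le_card_filter_le_card_inter_neighborFinset {δ : ℝ} {t : ℕ} {B F : Finset V}
    (hB : B.Nonempty) (ht : 4 * (t : ℝ) ≤ δ * #B)
    (hdeg : ∀ u ∈ B, δ * Fintype.card V ≤ H.degree u)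
    (hF : (#F : ℝ) ≤ δ / 2 * Fintype.card V) :
    δ / 4 * Fintype.card V ≤ #{y ∈ Fᶜ | t ≤ #(H.neighborFinset y ∩ B)} := by
  set Y : Finset V := {y ∈ Fᶜ | t ≤ #(H.neighborFinset y ∩ B)}
  have hcount : (#B : ℝ) * (δ / 2 * Fintype.card V) ≤ #Y * #B + Fintype.card V * t :=
    calc (#B : ℝ) * (δ / 2 * Fintype.card V)
        ≤ ∑ u ∈ B, (#(H.neighborFinset u ∩ Fᶜ) : ℝ) := by
          rw [← nsmul_eq_mul]
          refine card_nsmul_le_sum _ _ _ fun u hu => ?_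
          have h := le_card_sdiff F (H.neighborFinset u)
          rw [sdiff_eq_inter_compl, SimpleGraph.card_neighborFinset_eq_degree] at h
          have h' : (H.degree u : ℝ) ≤ #(H.neighborFinset u ∩ Fᶜ) + #F := mod_cast (by omega)
          linarith [hdeg u hu]
      _ = ∑ y ∈ Fᶜ, (#(H.neighborFinset y ∩ B) : ℝ) := by
          exact_mod_cast (card_interedges_eq_sum H B Fᶜ).symm.trans
            ((card_interedges_comm H B Fᶜ).trans (card_interedges_eq_sum H Fᶜ B))
      _ ≤ ∑ y ∈ Fᶜ, ((if t ≤ #(H.neighborFinset y ∩ B) then (#B : ℝ) else 0) + t) := by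
          gcongr with y
          split_ifs with hy
          · exact le_add_of_le_of_nonneg (mod_cast card_le_card inter_subset_right)
              (Nat.cast_nonneg t)
          · rw [zero_add]
            exact_mod_cast (not_le.1 hy).le
      _ ≤ #Y * #B + Fintype.card V * t := by
          rw [sum_add_distrib, ← sum_filter, sum_const, sum_const, nsmul_eq_mul, nsmul_eq_mul]
          gcongr
          exact card_le_univ _
  have hcard : (#B : ℝ) * (δ / 4 * Fintype.card V) ≤ #B * #Y := by
    have := mul_le_mul_of_nonneg_right ht (Nat.cast_nonneg (α := ℝ) (Fintype.card V))
    linarith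
  exact le_of_mul_le_mul_left hcard (by exact_mod_cast hB.card_pos)

/-- Pigeonhole on the neighbourhoods in `B`. -/
lemma exists_isCompleteBetween_of_mul_le_card {t k : ℕ} {B Y : Finset V}
    (hY : ∀ y ∈ Y, t ≤ #(H.neighborFinset y ∩ B)) (hk : 1 ≤ k) (hkY : 2 ^ #B * k ≤ #Y) :
    ∃ B' ⊆ B, #B' = t ∧ ∃ Y' ⊆ Y, #Y' = k ∧ H.IsCompleteBetween B' Y' := by
  choose! T hT hTcard using fun y hy => exists_subset_card_eq (hY y hy)
  obtain ⟨B', hB', hfiber⟩ := exists_le_card_fiber_of_mul_le_card_of_maps_to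
    (fun y hy => mem_powerset.2 ((hT y hy).trans inter_subset_right))
    ⟨∅, empty_mem_powerset _⟩ (by rwa [card_powerset])
  obtain ⟨y₀, hy₀⟩ := card_pos.1 (hk.trans hfiber)
  rw [mem_filter] at hy₀
  obtain ⟨Y', hY', hY'card⟩ := exists_subset_card_eq hfiber
  refine ⟨B', mem_powerset.1 hB', hy₀.2 ▸ hTcard y₀ hy₀.1, Y', hY'.trans (filter_subset _ _),
    hY'card, fun b hb y hy => ?_⟩
  obtain ⟨hyY, rfl⟩ := mem_filter.1 (hY' hy)
  exact ((H.mem_neighborFinset _ _).1 (mem_inter.1 (hT y hyY hb)).1).symm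

lemma exists_isCompleteBetween {δ : ℝ} {t k D : ℕ} (ht : 1 ≤ t) (hD : 4 * (t : ℝ) ≤ δ * D)
    (hk : 1 ≤ k) {B F : Finset V} (hB : D ≤ #B)
    (hdeg : ∀ u ∈ B, δ * Fintype.card V ≤ H.degree u)
    (hF : (#F : ℝ) ≤ δ / 2 * Fintype.card V)
    (hn : (k : ℝ) * 2 ^ (D + 2) ≤ δ * Fintype.card V) :
    ∃ B' ⊆ B, #B' = t ∧ ∃ Y, #Y = k ∧ Disjoint Y F ∧ H.IsCompleteBetween B' Y := by
  obtain ⟨B₀, hB₀, rfl⟩ := exists_subset_card_eq hB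
  have hB₀ne : B₀.Nonempty := by
    rw [nonempty_iff_ne_empty]
    rintro rfl
    rw [card_empty, Nat.cast_zero, mul_zero] at hD
    have : (1 : ℝ) ≤ t := mod_cast ht
    linarith
  have hmany := le_card_filter_le_card_inter_neighborFinset hB₀ne hD
    (fun u hu => hdeg u (hB₀ hu)) hF
  have hpigeon : ((2 ^ #B₀ * k : ℕ) : ℝ) ≤ δ / 4 * Fintype.card V := by
    push_cast
    rw [pow_add] at hn
    linarith
  obtain ⟨B', hB', hB'card, Y, hY, hYcard, hBY⟩ := exists_isCompleteBetween_of_mul_le_card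
    (fun y hy => (mem_filter.1 hy).2) hk (mod_cast hpigeon.trans hmany)
  exact ⟨B', hB'.trans hB₀, hB'card, Y, hYcard,
    disjoint_left.2 fun y hy => mem_compl.1 (mem_filter.1 (hY hy)).1, hBY⟩

end CommonNeighbours

namespace Labelling

section Imbalance

variable {V ι : Type*} {S : Labelling V ι} {G : SimpleGraph V} {i : ι}

/-- The label of a vertex: its cluster and its side. -/
def lab (S : Labelling V ι) (v : V) : ι × Bool := (S.cl v, S.side v)

/-- `1` and `-1` on the labels of the two sides of the cluster `i`, and `0` on other labels. Summed
over all vertices it gives the imbalance of the cluster. -/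
noncomputable def sideSign (i : ι) (q : ι × Bool) : ℝ :=
  if q.1 = i then (if q.2 then 1 else -1) else 0

lemma abs_sideSign_le_one (i : ι) (q : ι × Bool) : |sideSign i q| ≤ 1 := by
  unfold sideSign
  split_ifs <;> simp

lemma sideSign_lab_of_kept_adj {u v : V} (hi : i ∈ S.bip) (h : (S.kept G).Adj u v) :
    sideSign i (S.lab v) = -sideSign i (S.lab u) := by
  obtain ⟨-, hcl, hside⟩ := h
  unfold sideSign lab
  simp only [← hcl]
  by_cases hu : S.cl u = i
  · specialize hside (hu ▸ hi)
    cases hsu : S.side u <;> cases hsv : S.side v <;> simp_all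
  · simp [hu]

variable [Fintype V]

lemma sum_sideSign_mul_degree_kept (hi : i ∈ S.bip) :
    ∑ v, sideSign i (S.lab v) * ((S.kept G).degree v : ℝ) = 0 := by
  have hsum : ∑ v, sideSign i (S.lab v) * ((S.kept G).degree v : ℝ) =
      ∑ v, ∑ u, if (S.kept G).Adj v u then sideSign i (S.lab v) else 0 := by
    simp only [SimpleGraph.degree_eq_sum_if_adj, mul_sum, mul_ite, mul_one, mul_zero]
  have hneg : ∑ v, ∑ u, (if (S.kept G).Adj v u then sideSign i (S.lab v) else 0) =
      -∑ v, ∑ u, (if (S.kept G).Adj v u then sideSign i (S.lab v) else 0) := by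
    conv_lhs => rw [sum_comm]
    simp only [← sum_neg_distrib]
    refine sum_congr rfl fun v _ => sum_congr rfl fun u _ => ?_
    by_cases h : (S.kept G).Adj v u
    · rw [if_pos h, if_pos h.symm, sideSign_lab_of_kept_adj hi h]
    · rw [if_neg h, if_neg fun h' => h h'.symm, neg_zero]
  linarith

/-- Regularity turns the imbalance of a bipartite cluster into a signed count of lost edges. -/
lemma sum_sideSign_mul_degree_lost {d : ℕ} (hG : ∀ v, G.degree v = d) (hi : i ∈ S.bip) :
    ∑ v, sideSign i (S.lab v) * ((S.lost G).degree v : ℝ) = d * ∑ v, sideSign i (S.lab v) := by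
  have hdeg (v : V) : (d : ℝ) = (S.kept G).degree v + (S.lost G).degree v := by
    rw [← hG v]
    exact_mod_cast (S.degree_kept_add_degree_lost G v).symm
  calc ∑ v, sideSign i (S.lab v) * ((S.lost G).degree v : ℝ)
      = ∑ v, sideSign i (S.lab v) * ((S.kept G).degree v : ℝ) +
          ∑ v, sideSign i (S.lab v) * ((S.lost G).degree v : ℝ) := by
        rw [sum_sideSign_mul_degree_kept hi, zero_add]
    _ = ∑ v, d * sideSign i (S.lab v) := by
        rw [← sum_add_distrib]
        exact sum_congr rfl fun v _ => by rw [← mul_add, ← hdeg, mul_comm]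
    _ = d * ∑ v, sideSign i (S.lab v) := (mul_sum _ _ _).symm

end Imbalance

section Kinds

variable {V ι : Type*}

/-- The possible kinds of vertices: a label, together with the set of those labels in which the
vertex is incident with many lost edges. -/
abbrev Kind (ι : Type*) := (ι × Bool) × Finset (ι × Bool)

/-- The vertices of kind `a` are incident with many lost edges to the label of `b`. -/
def HeavyTowards (a b : Kind ι) : Prop := b.1 ∈ a.2

/-- The share of the lost edges from kind `a` to kind `b` that is attributed to `a`: everything if
only `a` is heavy towards the other kind, nothing if only `b` is, and one half otherwise. -/
noncomputable def share (a b : Kind ι) : ℝ :=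
  if HeavyTowards a b then (if HeavyTowards b a then 1 / 2 else 1)
  else if HeavyTowards b a then 0 else 1 / 2

lemma share_add_share (a b : Kind ι) : share a b + share b a = 1 := by
  unfold share
  split_ifs <;> norm_num

lemma share_nonneg (a b : Kind ι) : 0 ≤ share a b := by
  unfold share
  split_ifs <;> norm_num

lemma share_le_one (a b : Kind ι) : share a b ≤ 1 := by
  unfold share
  split_ifs <;> norm_num

lemma share_eq_zero {a b : Kind ι} (hab : ¬ HeavyTowards a b) (hba : HeavyTowards b a) :
    share a b = 0 := by
  simp [share, hab, hba]

lemma share_eq_half {a b : Kind ι} (hab : ¬ HeavyTowards a b) (hba : ¬ HeavyTowards b a) :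
    share a b = 1 / 2 := by
  simp [share, hab, hba]

variable [Fintype V] [Fintype ι]

/-- The labels towards which `v` has lost degree at least `s` times the number of vertices. -/
noncomputable def heavy (S : Labelling V ι) (G : SimpleGraph V) (s : ℝ) (v : V) :
    Finset (ι × Bool) :=
  {q | s * Fintype.card V ≤ #{u ∈ (S.lost G).neighborFinset v | S.lab u = q}}

/-- The kind of a vertex: its label, and the labels towards which it loses many edges. -/
noncomputable def kind (S : Labelling V ι) (G : SimpleGraph V) (s : ℝ) (v : V) : Kind ι :=
  (S.lab v, S.heavy G s v)

/-- The vertices of a given kind. -/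
noncomputable def kindSet (S : Labelling V ι) (G : SimpleGraph V) (s : ℝ) (a : Kind ι) :
    Finset V := {v | S.kind G s v = a}

/-- The vertices that lose many edges towards some label. -/
noncomputable def heavySet (S : Labelling V ι) (G : SimpleGraph V) (s : ℝ) : Finset V :=
  {v | (S.heavy G s v).Nonempty}

/-- The number of lost edges from kind `a` to kind `b`. -/
noncomputable def lostCount (S : Labelling V ι) (G : SimpleGraph V) (s : ℝ) (a b : Kind ι) : ℕ :=
  #((S.lost G).interedges (S.kindSet G s a) (S.kindSet G s b))

variable {S : Labelling V ι} {G : SimpleGraph V} {s : ℝ} {a b : Kind ι} {u v : V}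

lemma mem_kindSet : v ∈ S.kindSet G s a ↔ S.kind G s v = a := by
  simp [kindSet]

lemma lab_eq_of_kind_eq (hv : S.kind G s v = a) : S.lab v = a.1 := congrArg Prod.fst hv

lemma heavy_eq_of_kind_eq (hv : S.kind G s v = a) : S.heavy G s v = a.2 := congrArg Prod.snd hv

lemma heavy_eq_empty_of_notMem (hv : v ∉ S.heavySet G s) : S.heavy G s v = ∅ := by
  simpa [heavySet] using hv

lemma mem_heavy {q : ι × Bool} : q ∈ S.heavy G s v ↔
    s * Fintype.card V ≤ #{u ∈ (S.lost G).neighborFinset v | S.lab u = q} := by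
  simp [heavy]

lemma card_heavySet_mul_le :
    (#(S.heavySet G s) : ℝ) * (s * Fintype.card V) ≤ ∑ v, ((S.lost G).degree v : ℝ) :=
  calc (#(S.heavySet G s) : ℝ) * (s * Fintype.card V)
      ≤ ∑ v ∈ S.heavySet G s, ((S.lost G).degree v : ℝ) := by
        rw [← nsmul_eq_mul]
        refine card_nsmul_le_sum _ _ _ fun v hv => ?_
        obtain ⟨q, hq⟩ := (mem_filter.1 hv).2
        refine (mem_heavy.1 hq).trans ?_
        exact_mod_cast card_filter_le _ _
    _ ≤ ∑ v, ((S.lost G).degree v : ℝ) :=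
        sum_le_sum_of_subset_of_nonneg (subset_univ _) fun _ _ _ => Nat.cast_nonneg _

lemma lostCount_comm (a b : Kind ι) : S.lostCount G s a b = S.lostCount G s b a :=
  card_interedges_comm _ _ _

lemma sum_lostCount (a : Kind ι) :
    ∑ b, S.lostCount G s a b = ∑ v ∈ S.kindSet G s a, (S.lost G).degree v := by
  unfold lostCount
  simp_rw [card_interedges_eq_sum]
  rw [sum_comm]
  refine sum_congr rfl fun v _ => ?_
  rw [← SimpleGraph.card_neighborFinset_eq_degree,
    card_eq_sum_card_fiberwise (f := S.kind G s) (t := univ) fun _ _ => mem_coe.2 (mem_univ _)]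
  refine sum_congr rfl fun b _ => congrArg card ?_
  ext u
  rw [mem_inter, mem_filter, mem_kindSet]

lemma sum_sum_lostCount :
    ∑ p : Kind ι × Kind ι, S.lostCount G s p.1 p.2 = ∑ v, (S.lost G).degree v := by
  rw [Fintype.sum_prod_type]
  simp_rw [sum_lostCount]
  exact sum_fiberwise univ (S.kind G s) _

lemma card_neighborFinset_inter_kindSet_le (hab : ¬ HeavyTowards a b) (hv : v ∈ S.kindSet G s a) :
    (#((S.lost G).neighborFinset v ∩ S.kindSet G s b) : ℝ) ≤ s * Fintype.card V := by
  rw [mem_kindSet] at hv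
  have hnot : b.1 ∉ S.heavy G s v := heavy_eq_of_kind_eq hv ▸ hab
  rw [mem_heavy, not_le] at hnot
  refine le_trans (Nat.cast_le.2 (card_le_card fun u hu => ?_)) hnot.le
  rw [mem_inter, mem_kindSet] at hu
  exact mem_filter.2 ⟨hu.1, lab_eq_of_kind_eq hu.2⟩

lemma card_interedges_kindSet_le {X : Finset V} (hab : ¬ HeavyTowards a b)
    (hX : X ⊆ S.kindSet G s a) :
    (#((S.lost G).interedges X (S.kindSet G s b)) : ℝ) ≤ #X * (s * Fintype.card V) := by
  rw [card_interedges_eq_sum, ← nsmul_eq_mul]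
  push_cast
  exact sum_le_card_nsmul _ _ _ fun v hv => card_neighborFinset_inter_kindSet_le hab (hX hv)

end Kinds

section Demand

variable {V ι : Type*} [Fintype V] [Fintype ι]

/-- The number of copies of `K_{t,t}` to be placed for a pair `(a, b)` of kinds, with centre of
kind `a` and leaves in the label of `b`. Pairs with neither a heavy centre nor many lost edges are
skipped, as they have no greedy placement. -/
noncomputable def demand (S : Labelling V ι) (G : SimpleGraph V) (s : ℝ) (D d : ℕ)
    (p : Kind ι × Kind ι) : ℕ :=
  if ¬ HeavyTowards p.1 p.2 ∧ S.lostCount G s p.1 p.2 ≤ 2 * D * Fintype.card V then 0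
  else ⌊share p.1 p.2 * S.lostCount G s p.1 p.2 / d⌋₊

variable {S : Labelling V ι} {G : SimpleGraph V} {s c : ℝ} {D d : ℕ} {p : Kind ι × Kind ι}

lemma demand_le (p : Kind ι × Kind ι) :
    (S.demand G s D d p : ℝ) ≤ share p.1 p.2 * S.lostCount G s p.1 p.2 / d := by
  have hnonneg : 0 ≤ share p.1 p.2 * S.lostCount G s p.1 p.2 / d :=
    div_nonneg (mul_nonneg (share_nonneg _ _) (Nat.cast_nonneg _)) (Nat.cast_nonneg _)
  unfold demand
  split_ifs
  · exact_mod_cast hnonneg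
  · exact Nat.floor_le hnonneg

lemma demand_le_lostCount_div (p : Kind ι × Kind ι) :
    (S.demand G s D d p : ℝ) ≤ S.lostCount G s p.1 p.2 / d := by
  refine (demand_le p).trans ?_
  gcongr
  exact mul_le_of_le_one_left (Nat.cast_nonneg _) (share_le_one _ _)

lemma le_demand_add [Nonempty V] (hc : 0 < c) (hd : c * Fintype.card V ≤ d)
    (p : Kind ι × Kind ι) :
    share p.1 p.2 * S.lostCount G s p.1 p.2 / d ≤ S.demand G s D d p + (2 * D / c + 1) := by
  have hdpos : (0 : ℝ) < d :=
    (mul_pos hc (Nat.cast_pos.2 (Fintype.card_pos (α := V)))).trans_le hd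
  have hD : (0 : ℝ) ≤ 2 * D / c := by positivity
  unfold demand
  split_ifs with h
  · have hfew : share p.1 p.2 * S.lostCount G s p.1 p.2 / d ≤ 2 * D / c := by
      rw [div_le_div_iff₀ hdpos hc]
      calc share p.1 p.2 * S.lostCount G s p.1 p.2 * c
          ≤ 1 * (2 * D * Fintype.card V : ℕ) * c := by
            gcongr
            · exact share_le_one _ _
            · exact h.2
        _ = 2 * D * (c * Fintype.card V) := by push_cast; ring
        _ ≤ 2 * D * d := by gcongr
    rw [Nat.cast_zero]
    linarith
  · linarith [Nat.lt_floor_add_one (share p.1 p.2 * S.lostCount G s p.1 p.2 / d)]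

lemma sum_demand_le [Nonempty V] {η δ : ℝ} (hS : S.IsGood G η δ) (hc : 0 < c)
    (hd : c * Fintype.card V ≤ d) :
    ∑ p, (S.demand G s D d p : ℝ) ≤ η / c * Fintype.card V := by
  have _ : (0 : ℝ) < Fintype.card V := Nat.cast_pos.2 Fintype.card_pos
  have hη := hS.nonneg
  calc ∑ p, (S.demand G s D d p : ℝ)
      ≤ ∑ p : Kind ι × Kind ι, (S.lostCount G s p.1 p.2 : ℝ) / d :=
        sum_le_sum fun p _ => demand_le_lostCount_div p
    _ = (∑ v, ((S.lost G).degree v : ℝ)) / d := by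
        rw [← sum_div]
        exact congrArg (· / _) (mod_cast sum_sum_lostCount)
    _ ≤ η * (Fintype.card V : ℝ) ^ 2 / (c * Fintype.card V) := by
        gcongr
        exact hS.sum_degree_lost_le
    _ = η / c * Fintype.card V := by field_simp

lemma kindSet_nonempty_of_demand_pos (hp : 0 < S.demand G s D d p) :
    (S.kindSet G s p.1).Nonempty := by
  rw [nonempty_iff_ne_empty]
  intro hempty
  have hzero : S.lostCount G s p.1 p.2 = 0 := by simp [lostCount, hempty]
  have hle := demand_le (S := S) (G := G) (s := s) (D := D) (d := d) p
  rw [hzero, Nat.cast_zero, mul_zero, zero_div] at hle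
  exact hp.not_ge (mod_cast hle)

lemma not_heavyTowards_of_demand_pos (hp : 0 < S.demand G s D d p)
    (hab : ¬ HeavyTowards p.1 p.2) : ¬ HeavyTowards p.2 p.1 := by
  intro hba
  have hle := demand_le (S := S) (G := G) (s := s) (D := D) (d := d) p
  rw [share_eq_zero hab hba, zero_mul, zero_div] at hle
  exact hp.not_ge (mod_cast hle)

lemma lt_lostCount_of_demand_pos (hp : 0 < S.demand G s D d p)
    (hab : ¬ HeavyTowards p.1 p.2) : 2 * D * Fintype.card V < S.lostCount G s p.1 p.2 := by
  by_contra! hle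
  exact hp.ne' (if_pos ⟨hab, hle⟩)

/-- A pair whose centres are not heavy has no demand if its leaves are heavy, and few lost edges
otherwise. -/
lemma demand_le_of_not_heavyTowards [Nonempty V] (hc : 0 < c) (hs : 0 ≤ s)
    (hd : c * Fintype.card V ≤ d) (hab : ¬ HeavyTowards p.1 p.2) :
    (S.demand G s D d p : ℝ) ≤ #(S.kindSet G s p.2) * s / (2 * c) := by
  refine (demand_le p).trans ?_
  by_cases hba : HeavyTowards p.2 p.1
  · rw [share_eq_zero hab hba, zero_mul, zero_div]
    positivity
  · have _ : (0 : ℝ) < Fintype.card V := Nat.cast_pos.2 Fintype.card_pos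
    rw [share_eq_half hab hba, lostCount_comm]
    calc 1 / 2 * (S.lostCount G s p.2 p.1 : ℝ) / d
        ≤ 1 / 2 * (#(S.kindSet G s p.2) * (s * Fintype.card V)) / (c * Fintype.card V) := by
          gcongr
          exact card_interedges_kindSet_le hba subset_rfl
      _ = #(S.kindSet G s p.2) * s / (2 * c) := by field_simp

end Demand

section Gadgets

variable {V ι : Type*} [Fintype V] [Fintype ι]

/-- A copy of `K_{t,t}` in `G` with classes `insert v Y` and `B`, placed for the pair `p` of kinds:
the centre `v` has kind `p.1`, the leaves `B` have the label of `p.2`, and the vertices of `Y` are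
common neighbours of the leaves along edges that are not lost. On a bipartite cluster, `Y` cancels
all but one of the leaves, so that the copy changes the imbalance as the two ends of a single edge
do. -/
structure IsGadget (S : Labelling V ι) (G : SimpleGraph V) (s : ℝ) (t : ℕ) (p : Kind ι × Kind ι)
    (v : V) (Y B : Finset V) : Prop where
  kind_centre : S.kind G s v = p.1
  lab_leaves : ∀ u ∈ B, S.lab u = p.2.1
  adj_leaves : ∀ u ∈ B, G.Adj v u
  isCompleteBetween_kept : (S.kept G).IsCompleteBetween B Y
  card_leaves : #B = t
  card_common : #Y = t - 1
  centre_notMem : v ∉ Y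
  light_leaves : ∀ u ∈ B, S.heavy G s u = ∅ ∨ (S.kind G s u = p.2 ∧ ¬ HeavyTowards p.1 p.2)
  light_common : ∀ y ∈ Y, S.heavy G s y = ∅

/-- The set `U` is a disjoint union of gadgets, with `g p` of them placed for the pair `p`. -/
inductive IsGadgetUnion (S : Labelling V ι) (G : SimpleGraph V) (s : ℝ) (t : ℕ) :
    Finset V → (Kind ι × Kind ι → ℕ) → Prop
  | empty : IsGadgetUnion S G s t ∅ 0
  | add {U : Finset V} {g : Kind ι × Kind ι → ℕ} {p : Kind ι × Kind ι} {v : V} {Y B : Finset V}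
      (hU : IsGadgetUnion S G s t U g) (hp : S.IsGadget G s t p v Y B)
      (hdisj : Disjoint (insert v Y ∪ B) U) :
      IsGadgetUnion S G s t (insert v Y ∪ B ∪ U) (g + Pi.single p 1)

/-- A bound on the number of vertices of kind `a`, assumed heavy, in a gadget for the pair `p`. -/
noncomputable def usage (t : ℕ) (a : Kind ι) (p : Kind ι × Kind ι) : ℝ :=
  (if p.1 = a then 1 else 0) + if p.2 = a ∧ ¬ HeavyTowards p.1 p.2 then (t : ℝ) else 0

variable {S : Labelling V ι} {G : SimpleGraph V} {s : ℝ} {t : ℕ} {p : Kind ι × Kind ι}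
  {g : Kind ι × Kind ι → ℕ} {v : V} {Y B U : Finset V}

namespace IsGadget

lemma isCompleteBetween (hp : S.IsGadget G s t p v Y B) :
    G.IsCompleteBetween (insert v Y : Finset V) B := by
  intro x hx b hb
  rcases mem_insert.1 hx with rfl | hx
  · exact hp.adj_leaves b hb
  · exact (kept_le (hp.isCompleteBetween_kept hb hx)).symm

lemma disjoint (hp : S.IsGadget G s t p v Y B) : Disjoint (insert v Y) B :=
  disjoint_coe.1 hp.isCompleteBetween.disjoint

lemma card_insert_common (hp : S.IsGadget G s t p v Y B) (ht : 1 ≤ t) : #(insert v Y) = t := by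
  rw [card_insert_of_notMem hp.centre_notMem, hp.card_common, Nat.sub_add_cancel ht]

lemma sum_union {M : Type*} [AddCommMonoid M] (hp : S.IsGadget G s t p v Y B) (φ : V → M) :
    ∑ x ∈ insert v Y ∪ B, φ x = φ v + ∑ y ∈ Y, φ y + ∑ b ∈ B, φ b := by
  rw [Finset.sum_union hp.disjoint, sum_insert hp.centre_notMem]

lemma sum_sideSign {i : ι} (hp : S.IsGadget G s t p v Y B) (ht : 1 ≤ t) (hi : i ∈ S.bip) :
    ∑ x ∈ insert v Y ∪ B, sideSign i (S.lab x) = sideSign i p.1.1 + sideSign i p.2.1 := by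
  obtain ⟨b, hb⟩ : B.Nonempty := card_pos.1 (hp.card_leaves ▸ ht)
  have hleaves : ∑ u ∈ B, sideSign i (S.lab u) = t * sideSign i p.2.1 := by
    rw [sum_congr rfl fun u hu => by rw [hp.lab_leaves u hu], sum_const, hp.card_leaves,
      nsmul_eq_mul]
  have hcommon : ∑ y ∈ Y, sideSign i (S.lab y) = (t - 1 : ℝ) * -sideSign i p.2.1 := by
    rw [sum_congr rfl fun y hy => sideSign_lab_of_kept_adj hi (hp.isCompleteBetween_kept hb hy),
      sum_const, hp.card_common, nsmul_eq_mul, hp.lab_leaves b hb, Nat.cast_sub ht, Nat.cast_one]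
  rw [hp.sum_union, hleaves, hcommon, lab_eq_of_kind_eq hp.kind_centre]
  ring

lemma sum_ite_kind_le {a : Kind ι} (hp : S.IsGadget G s t p v Y B) (ha : a.2.Nonempty) :
    ∑ x ∈ insert v Y ∪ B, (if S.kind G s x = a then 1 else 0) ≤ usage t a p := by
  have hne {x : V} (hx : S.heavy G s x = ∅) : S.kind G s x ≠ a := fun h =>
    ha.ne_empty (heavy_eq_of_kind_eq h ▸ hx)
  have hcommon : ∑ y ∈ Y, (if S.kind G s y = a then (1 : ℝ) else 0) = 0 :=
    sum_eq_zero fun y hy => if_neg (hne (hp.light_common y hy))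
  rw [hp.sum_union, hcommon, add_zero, hp.kind_centre, usage]
  gcongr
  split_ifs with h
  · rw [sum_boole]
    exact_mod_cast (card_filter_le _ _).trans hp.card_leaves.le
  · refine (sum_eq_zero fun u hu => if_neg ?_).le
    rcases hp.light_leaves u hu with hlight | ⟨hkind, hnot⟩
    · exact hne hlight
    · exact fun hu => h ⟨hkind.symm.trans hu, hnot⟩

end IsGadget

namespace IsGadgetUnion

lemma hasPackingOn (ht : 1 ≤ t) (hU : S.IsGadgetUnion G s t U g) :
    HasPackingOn (completeBipartiteGraph (Fin t) (Fin t)) G U := by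
  induction hU with
  | empty => simpa using hasPackingOn_empty
  | add _ hp hdisj ih =>
    rw [coe_union, coe_union]
    refine HasPackingOn.union (hasPackingOn_of_isCompleteBetween (hp.card_insert_common ht)
      hp.card_leaves hp.isCompleteBetween) ih ?_
    rwa [← coe_union, disjoint_coe]

lemma sum_le {φ : V → ℝ} {w : Kind ι × Kind ι → ℝ} (hU : S.IsGadgetUnion G s t U g)
    (hφ : ∀ p v Y B, S.IsGadget G s t p v Y B → ∑ x ∈ insert v Y ∪ B, φ x ≤ w p) :
    ∑ x ∈ U, φ x ≤ ∑ q, (g q : ℝ) * w q := by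
  induction hU with
  | empty => simp
  | @add U g p v Y B _ hp hdisj ih =>
    have hcount : ∑ q, ((g + Pi.single p 1 : Kind ι × Kind ι → ℕ) q : ℝ) * w q =
        w p + ∑ q, (g q : ℝ) * w q := by
      simp [add_mul, sum_add_distrib, Pi.single_apply, add_comm]
    rw [sum_union hdisj, hcount]
    exact add_le_add (hφ _ _ _ _ hp) ih

lemma sum_eq {φ : V → ℝ} {w : Kind ι × Kind ι → ℝ} (hU : S.IsGadgetUnion G s t U g)
    (hφ : ∀ p v Y B, S.IsGadget G s t p v Y B → ∑ x ∈ insert v Y ∪ B, φ x = w p) :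
    ∑ x ∈ U, φ x = ∑ q, (g q : ℝ) * w q := by
  refine le_antisymm (hU.sum_le fun p v Y B hp => (hφ p v Y B hp).le) ?_
  have hneg := hU.sum_le (φ := fun x => -φ x) (w := fun q => -w q) fun p v Y B hp => by
    rw [sum_neg_distrib, hφ p v Y B hp]
  simpa only [mul_neg, sum_neg_distrib, neg_le_neg_iff] using hneg

lemma sum_sideSign {i : ι} (ht : 1 ≤ t) (hi : i ∈ S.bip) (hU : S.IsGadgetUnion G s t U g) :
    ∑ v ∈ U, sideSign i (S.lab v) = ∑ q, (g q : ℝ) * (sideSign i q.1.1 + sideSign i q.2.1) :=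
  hU.sum_eq fun _ _ _ _ hp => hp.sum_sideSign ht hi

lemma card_eq (ht : 1 ≤ t) (hU : S.IsGadgetUnion G s t U g) :
    (#U : ℝ) = 2 * t * ∑ q, (g q : ℝ) := by
  have hsum := hU.sum_eq (φ := fun _ => 1) (w := fun _ => 2 * t) fun p v Y B hp => by
    rw [sum_const, card_union_of_disjoint hp.disjoint, hp.card_insert_common ht, hp.card_leaves,
      nsmul_one, Nat.cast_add, two_mul]
  rw [← sum_mul, mul_comm] at hsum
  simpa using hsum

lemma card_filter_kind_le {a : Kind ι} (ha : a.2.Nonempty) (hU : S.IsGadgetUnion G s t U g) :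
    (#{v ∈ U | S.kind G s v = a} : ℝ) ≤ ∑ q, (g q : ℝ) * usage t a q := by
  rw [← sum_boole]
  exact hU.sum_le fun p v Y B hp => hp.sum_ite_kind_le ha

end IsGadgetUnion

end Gadgets

end Labelling

section Greedy

lemma greedy_induction {P α : Type*} [Finite P] [DecidableEq P] [LinearOrder α] {k : P → ℕ}
    (rank : P → α) {Q : (P → ℕ) → Prop} (zero : Q 0)
    (step : ∀ g p, Q g → g ≤ k → g p < k p → (∀ q, rank p < rank q → g q = 0) →
      Q (g + Pi.single p 1)) : Q k := by
  have := Fintype.ofFinite P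
  suffices h : ∀ m g, ∑ q, (k q - g q) = m → Q g → g ≤ k →
      (∀ p q, g p < k p → rank p < rank q → g q = 0) → Q k from
    h _ 0 rfl zero (fun _ => Nat.zero_le _) fun _ _ _ _ => rfl
  intro m
  induction m using Nat.strong_induction_on with
  | _ m ih =>
    rintro g rfl hQ hgk hzero
    by_cases hdone : k ≤ g
    · rwa [le_antisymm hdone hgk]
    obtain ⟨p₀, hp₀⟩ : ∃ p, g p < k p := by simpa [Pi.le_def] using hdone
    obtain ⟨p, hp, hmin⟩ := exists_min_image {p | g p < k p} rank ⟨p₀, by simpa using hp₀⟩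
    simp only [mem_filter_univ] at hp hmin
    set g' : P → ℕ := g + Pi.single p 1
    have hgg' : g ≤ g' := le_self_add
    have hp' : g' p = g p + 1 := by simp [g']
    have hne {q : P} (hq : q ≠ p) : g' q = g q := by simp [g', hq]
    refine ih _ (sum_lt_sum (fun q _ => Nat.sub_le_sub_left (hgg' q) _)
      ⟨p, mem_univ p, by omega⟩) g' rfl (step g p hQ hgk hp fun q => hzero p q hp) (fun q => ?_)
      fun q q' hq hqq' => ?_
    · rcases eq_or_ne q p with rfl | hq
      · exact hp'.trans_le hp
      · exact (hne hq).trans_le (hgk q)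
    · have hgq : g q < k q := (hgg' q).trans_lt hq
      rw [hne (ne_of_apply_ne rank ((hmin q hgq).trans_lt hqq').ne'), hzero q q' hgq hqq']

end Greedy

section Interedges

variable {V : Type*}

lemma card_interedges_le_add_add (H : SimpleGraph V) (A B U : Finset V) :
    #(H.interedges A B) ≤ #(H.interedges (A ∩ U) B) + #(H.interedges A (B ∩ U)) +
      #(H.interedges (A \ U) (B \ U)) := by
  have hcover : H.interedges A B ⊆
      H.interedges (A ∩ U) B ∪ H.interedges A (B ∩ U) ∪ H.interedges (A \ U) (B \ U) := by
    rintro ⟨x, y⟩ hxy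
    simp only [mem_union, SimpleGraph.mem_interedges_iff, mem_inter, mem_sdiff] at hxy ⊢
    tauto
  exact (card_le_card hcover).trans <|
    (card_union_le _ _).trans <| Nat.add_le_add_right (card_union_le _ _) _

lemma exists_le_card_neighborFinset_inter [Fintype V] {H : SimpleGraph V} {A B : Finset V} {D : ℕ}
    (h : Fintype.card V * D < #(H.interedges A B)) :
    ∃ v ∈ A, D ≤ #(H.neighborFinset v ∩ B) := by
  by_contra! hlt
  refine h.not_ge ?_
  rw [card_interedges_eq_sum]
  exact (sum_le_card_nsmul _ _ _ fun v hv => (hlt v hv).le).trans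
    (Nat.mul_le_mul_right _ (card_le_univ A))

end Interedges

namespace Labelling

variable {V ι : Type*} [Fintype V] [Fintype ι]

/-- The relations between the parameters under which all demands can be met greedily: losing `s n`
edges towards a label is heavy, and `D` candidates for leaves suffice for a gadget. -/
structure IsCalibrated (S : Labelling V ι) (G : SimpleGraph V) (d t D : ℕ) (c δ s η : ℝ) :
    Prop where
  c_pos : 0 < c
  δ_pos : 0 < δ
  s_pos : 0 < s
  two_le : 2 ≤ t
  degree_eq : ∀ v, G.degree v = d
  le_degree : c * Fintype.card V ≤ d
  isGood : S.IsGood G η δ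
  four_mul_le : 4 * (t : ℝ) ≤ δ * D
  mul_pow_le : (t : ℝ) * 2 ^ (D + 2) ≤ δ * Fintype.card V
  mul_s_le_c : 4 * t * (Fintype.card (Kind ι × Kind ι) : ℝ) * s ≤ c
  mul_s_le_c_mul_δ : 2 * t * (Fintype.card (Kind ι) : ℝ) * s ≤ c * δ
  s_le_half_δ : s ≤ δ / 2
  room : 2 * t * (η / c * Fintype.card V) + η / s * Fintype.card V + D + 1 ≤ s * Fintype.card V

namespace IsCalibrated

variable {S : Labelling V ι} {G : SimpleGraph V} {d t D : ℕ} {c δ s η : ℝ}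
  {U : Finset V} {g : Kind ι × Kind ι → ℕ} {p : Kind ι × Kind ι}

lemma one_le (hS : S.IsCalibrated G d t D c δ s η) : 1 ≤ t := one_le_two.trans hS.two_le

lemma degree_lost_le (hS : S.IsCalibrated G d t D c δ s η) (v : V) :
    ((S.lost G).degree v : ℝ) ≤ (1 - δ) * d := by
  have hsum : ((S.kept G).degree v : ℝ) + (S.lost G).degree v = d := by
    rw [← hS.degree_eq v]
    exact_mod_cast S.degree_kept_add_degree_lost G v
  have hd : (d : ℝ) ≤ Fintype.card V := by
    rw [← hS.degree_eq v]
    exact_mod_cast degree_le_card G v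
  have hkept := hS.isGood.le_degree_kept v
  have hδd := mul_le_mul_of_nonneg_left hd hS.δ_pos.le
  linarith

variable [Nonempty V]

lemma degree_pos (hS : S.IsCalibrated G d t D c δ s η) : (0 : ℝ) < d :=
  (mul_pos hS.c_pos (Nat.cast_pos.2 (Fintype.card_pos (α := V)))).trans_le hS.le_degree

lemma card_heavySet_le (hS : S.IsCalibrated G d t D c δ s η) :
    (#(S.heavySet G s) : ℝ) ≤ η / s * Fintype.card V := by
  have hn : (0 : ℝ) < Fintype.card V := Nat.cast_pos.2 Fintype.card_pos
  have hle := (card_heavySet_mul_le (S := S) (G := G) (s := s)).trans hS.isGood.sum_degree_lost_le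
  rw [div_mul_eq_mul_div, le_div_iff₀ hS.s_pos]
  exact le_of_mul_le_mul_right (by linarith) hn

lemma card_le (hS : S.IsCalibrated G d t D c δ s η) (hU : S.IsGadgetUnion G s t U g)
    (hg : g ≤ S.demand G s D d) : (#U : ℝ) ≤ 2 * t * (η / c * Fintype.card V) := by
  rw [hU.card_eq hS.one_le]
  gcongr
  exact (sum_le_sum fun q _ => Nat.cast_le.2 (hg q)).trans
    (sum_demand_le hS.isGood hS.c_pos hS.le_degree)

lemma card_union_heavySet_le (hS : S.IsCalibrated G d t D c δ s η)
    (hU : S.IsGadgetUnion G s t U g) (hg : g ≤ S.demand G s D d) :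
    (#(U ∪ S.heavySet G s) : ℝ) + D + 1 ≤ s * Fintype.card V := by
  have hle : (#(U ∪ S.heavySet G s) : ℝ) ≤ #U + #(S.heavySet G s) :=
    mod_cast card_union_le _ _
  linarith [hS.card_le hU hg, hS.card_heavySet_le, hS.room]

lemma exists_gadget_of_leaves (hS : S.IsCalibrated G d t D c δ s η)
    (hU : S.IsGadgetUnion G s t U g) (hg : g ≤ S.demand G s D d) {v : V} {B : Finset V}
    (hv : S.kind G s v = p.1) (hvU : v ∉ U) (hB : D ≤ #B) (hBU : Disjoint B U)
    (hlab : ∀ u ∈ B, S.lab u = p.2.1) (hadj : B ⊆ (S.lost G).neighborFinset v)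
    (hlight : ∀ u ∈ B, S.heavy G s u = ∅ ∨ (S.kind G s u = p.2 ∧ ¬ HeavyTowards p.1 p.2)) :
    ∃ v Y B, S.IsGadget G s t p v Y B ∧ Disjoint (insert v Y ∪ B) U := by
  have hF : (#(insert v (U ∪ S.heavySet G s)) : ℝ) ≤ δ / 2 * Fintype.card V := by
    have hinsert : (#(insert v (U ∪ S.heavySet G s)) : ℝ) ≤ #(U ∪ S.heavySet G s) + 1 :=
      mod_cast card_insert_le _ _
    have hs := mul_le_mul_of_nonneg_right hS.s_le_half_δ (Nat.cast_nonneg (Fintype.card V))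
    linarith [hS.card_union_heavySet_le hU hg, Nat.cast_nonneg (α := ℝ) D]
  have hpow : ((t - 1 : ℕ) : ℝ) * 2 ^ (D + 2) ≤ δ * Fintype.card V := le_trans
    (mul_le_mul_of_nonneg_right (Nat.cast_le.2 (Nat.sub_le t 1)) (by positivity)) hS.mul_pow_le
  obtain ⟨B', hB'B, hB', Y, hY, hYF, hB'Y⟩ := exists_isCompleteBetween hS.one_le hS.four_mul_le
    (Nat.le_sub_one_of_lt hS.two_le) hB (fun u _ => hS.isGood.le_degree_kept u) hF hpow
  rw [disjoint_insert_right, disjoint_union_right] at hYF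
  obtain ⟨hvY, hYU, hYheavy⟩ := hYF
  refine ⟨v, Y, B', ⟨hv, fun u hu => hlab u (hB'B hu), fun u hu => ?_, hB'Y, hB', hY, hvY,
    fun u hu => hlight u (hB'B hu), fun y hy => ?_⟩, ?_⟩
  · exact lost_le ((SimpleGraph.mem_neighborFinset _ _ _).1 (hadj (hB'B hu)))
  · exact heavy_eq_empty_of_notMem (disjoint_left.1 hYheavy hy)
  · rw [disjoint_union_left, disjoint_insert_left]
    exact ⟨⟨hvU, hYU⟩, hBU.mono_left hB'B⟩

section HeavyCentre

lemma sum_demand_fst_le (hS : S.IsCalibrated G d t D c δ s η) (a : Kind ι) :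
    ∑ b, (S.demand G s D d (a, b) : ℝ) ≤ (1 - δ) * #(S.kindSet G s a) :=
  calc ∑ b, (S.demand G s D d (a, b) : ℝ)
      ≤ ∑ b, (S.lostCount G s a b : ℝ) / d := sum_le_sum fun b _ => demand_le_lostCount_div (a, b)
    _ = (∑ v ∈ S.kindSet G s a, ((S.lost G).degree v : ℝ)) / d := by
        rw [← sum_div]
        exact congrArg (· / _) (mod_cast sum_lostCount a)
    _ ≤ (1 - δ) * #(S.kindSet G s a) := by
        rw [div_le_iff₀ hS.degree_pos]
        refine (sum_le_card_nsmul _ _ _ fun v _ => hS.degree_lost_le v).trans_eq ?_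
        rw [nsmul_eq_mul]
        ring

lemma demand_mul_usage_le (hS : S.IsCalibrated G d t D c δ s η) (a x b : Kind ι) :
    (S.demand G s D d (x, b) : ℝ) * usage t a (x, b) ≤
      (if x = a then (S.demand G s D d (a, b) : ℝ) else 0) +
        if b = a then #(S.kindSet G s a) * s / (2 * c) * t else 0 := by
  have hc := hS.c_pos
  have hs := hS.s_pos
  rw [usage, mul_add]
  gcongr ?_ + ?_
  · split_ifs with hx
    · rw [mul_one, ← hx]
    · rw [mul_zero]
  · by_cases hb : b = a
    · subst hb
      by_cases hheavy : HeavyTowards x b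
      · simp only [hheavy, not_true, and_false, if_false, mul_zero, if_true]
        positivity
      · simp only [hheavy, not_false_iff, and_self, if_true]
        gcongr
        exact demand_le_of_not_heavyTowards hc hs.le hS.le_degree hheavy
    · simp [hb]

lemma sum_demand_mul_usage_le (hS : S.IsCalibrated G d t D c δ s η) (a : Kind ι) :
    ∑ q, (S.demand G s D d q : ℝ) * usage t a q ≤ (1 - 3 / 4 * δ) * #(S.kindSet G s a) := by
  have hc := hS.c_pos
  have hleaves : Fintype.card (Kind ι) * (#(S.kindSet G s a) * s / (2 * c) * t) ≤
      δ / 4 * #(S.kindSet G s a) :=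
    calc Fintype.card (Kind ι) * (#(S.kindSet G s a) * s / (2 * c) * t)
        = (2 * t * Fintype.card (Kind ι) * s) * (#(S.kindSet G s a) / (4 * c)) := by
          field_simp
          ring
      _ ≤ c * δ * (#(S.kindSet G s a) / (4 * c)) :=
          mul_le_mul_of_nonneg_right hS.mul_s_le_c_mul_δ (by positivity)
      _ = δ / 4 * #(S.kindSet G s a) := by field_simp
  calc ∑ q, (S.demand G s D d q : ℝ) * usage t a q
      ≤ ∑ x, ∑ b, ((if x = a then (S.demand G s D d (a, b) : ℝ) else 0) +
          if b = a then #(S.kindSet G s a) * s / (2 * c) * t else 0) := by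
        rw [Fintype.sum_prod_type]
        exact sum_le_sum fun x _ => sum_le_sum fun b _ => hS.demand_mul_usage_le a x b
    _ = ∑ b, (S.demand G s D d (a, b) : ℝ) +
          Fintype.card (Kind ι) * (#(S.kindSet G s a) * s / (2 * c) * t) := by
        simp only [sum_add_distrib]
        rw [sum_comm]
        simp
    _ ≤ (1 - δ) * #(S.kindSet G s a) + δ / 4 * #(S.kindSet G s a) :=
        add_le_add (hS.sum_demand_fst_le a) hleaves
    _ = (1 - 3 / 4 * δ) * #(S.kindSet G s a) := by ring

lemma exists_mem_kindSet_notMem (hS : S.IsCalibrated G d t D c δ s η)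
    (hU : S.IsGadgetUnion G s t U g) (hg : g ≤ S.demand G s D d) {a : Kind ι}
    (ha : a.2.Nonempty) (hane : (S.kindSet G s a).Nonempty) :
    ∃ v ∈ S.kindSet G s a, v ∉ U := by
  by_contra! hsub
  have hall : (#(S.kindSet G s a) : ℝ) ≤ #{v ∈ U | S.kind G s v = a} :=
    mod_cast card_le_card fun v hv => mem_filter.2 ⟨hsub v hv, mem_kindSet.1 hv⟩
  have hused : (#{v ∈ U | S.kind G s v = a} : ℝ) ≤ (1 - 3 / 4 * δ) * #(S.kindSet G s a) := by
    refine (hU.card_filter_kind_le ha).trans (le_trans ?_ (hS.sum_demand_mul_usage_le a))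
    gcongr with q
    · unfold usage
      positivity
    · exact hg q
  have hpos : 0 < δ * #(S.kindSet G s a) := mul_pos hS.δ_pos (Nat.cast_pos.2 hane.card_pos)
  linarith

/-- Centres are used up at most at rate `1 - δ`, because the kept degrees are linear. -/
lemma exists_gadget_of_heavyTowards (hS : S.IsCalibrated G d t D c δ s η)
    (hU : S.IsGadgetUnion G s t U g) (hg : g ≤ S.demand G s D d)
    (hgp : g p < S.demand G s D d p) (hp : HeavyTowards p.1 p.2) :
    ∃ v Y B, S.IsGadget G s t p v Y B ∧ Disjoint (insert v Y ∪ B) U := by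
  obtain ⟨v, hv, hvU⟩ := hS.exists_mem_kindSet_notMem hU hg ⟨_, hp⟩
    (kindSet_nonempty_of_demand_pos (Nat.zero_lt_of_lt hgp))
  rw [mem_kindSet] at hv
  set N : Finset V := {u ∈ (S.lost G).neighborFinset v | S.lab u = p.2.1}
  have hN : s * Fintype.card V ≤ #N := mem_heavy.1 ((heavy_eq_of_kind_eq hv).symm ▸ hp)
  have hfree : D ≤ #(N \ (U ∪ S.heavySet G s)) := by
    have hroom : D + #(U ∪ S.heavySet G s) ≤ #N := by
      have h := hS.card_union_heavySet_le hU hg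
      have hle : (D : ℝ) + #(U ∪ S.heavySet G s) ≤ #N := by linarith
      exact_mod_cast hle
    have := le_card_sdiff (U ∪ S.heavySet G s) N
    omega
  have hmem {u : V} (hu : u ∈ N \ (U ∪ S.heavySet G s)) :
      (u ∈ (S.lost G).neighborFinset v ∧ S.lab u = p.2.1) ∧ u ∉ U ∧ u ∉ S.heavySet G s := by
    rwa [mem_sdiff, mem_filter, mem_union, not_or] at hu
  exact hS.exists_gadget_of_leaves hU hg hv hvU hfree
    (disjoint_left.2 fun u hu => (hmem hu).2.1) (fun u hu => (hmem hu).1.2)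
    (fun u hu => (hmem hu).1.1) fun u hu => .inl (heavy_eq_empty_of_notMem (hmem hu).2.2)

end HeavyCentre

section LightCentre

/-- The vertices used so far meet only a quarter of the lost edges, because no pair has had more
gadgets placed than `p` demands. -/
lemma card_mul_le_lostCount (hS : S.IsCalibrated G d t D c δ s η)
    (hU : S.IsGadgetUnion G s t U g) (hg : ∀ q, g q ≤ S.demand G s D d p)
    (hshare : share p.1 p.2 = 1 / 2) :
    (#U : ℝ) * (s * Fintype.card V) ≤ S.lostCount G s p.1 p.2 / 4 := by
  have _ : (0 : ℝ) < Fintype.card V := Nat.cast_pos.2 Fintype.card_pos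
  have hc := hS.c_pos
  have hs := hS.s_pos
  have hdemand : (S.demand G s D d p : ℝ) ≤
      1 / 2 * S.lostCount G s p.1 p.2 / (c * Fintype.card V) := by
    refine (demand_le p).trans ?_
    rw [hshare]
    gcongr
    exact hS.le_degree
  have hsum : ∑ q, (g q : ℝ) ≤ Fintype.card (Kind ι × Kind ι) * S.demand G s D d p := by
    rw [← nsmul_eq_mul]
    exact sum_le_card_nsmul _ _ _ fun q _ => Nat.cast_le.2 (hg q)
  calc (#U : ℝ) * (s * Fintype.card V)
      ≤ 2 * t * (Fintype.card (Kind ι × Kind ι) *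
          (1 / 2 * S.lostCount G s p.1 p.2 / (c * Fintype.card V))) * (s * Fintype.card V) := by
        rw [hU.card_eq hS.one_le]
        gcongr
        exact hsum.trans (by gcongr)
    _ = (4 * t * Fintype.card (Kind ι × Kind ι) * s) * (S.lostCount G s p.1 p.2 / (4 * c)) := by
        field_simp
    _ ≤ c * (S.lostCount G s p.1 p.2 / (4 * c)) := by
        gcongr
        exact hS.mul_s_le_c
    _ = S.lostCount G s p.1 p.2 / 4 := by field_simp

lemma lt_card_interedges_sdiff (hS : S.IsCalibrated G d t D c δ s η)
    (hU : S.IsGadgetUnion G s t U g) (hg : ∀ q, g q ≤ S.demand G s D d p)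
    (hab : ¬ HeavyTowards p.1 p.2) (hba : ¬ HeavyTowards p.2 p.1)
    (hlost : 2 * D * Fintype.card V < S.lostCount G s p.1 p.2) :
    Fintype.card V * D <
      #((S.lost G).interedges (S.kindSet G s p.1 \ U) (S.kindSet G s p.2 \ U)) := by
  have hs := hS.s_pos
  have hquarter := hS.card_mul_le_lostCount hU hg (share_eq_half hab hba)
  have hused {a b : Kind ι} (hnot : ¬ HeavyTowards a b) :
      (#((S.lost G).interedges (S.kindSet G s a ∩ U) (S.kindSet G s b)) : ℝ) ≤
        S.lostCount G s p.1 p.2 / 4 := by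
    refine (card_interedges_kindSet_le hnot inter_subset_left).trans (le_trans ?_ hquarter)
    gcongr
    exact inter_subset_right
  have hsplit : (S.lostCount G s p.1 p.2 : ℝ) ≤ _ := Nat.cast_le.2
    (card_interedges_le_add_add (S.lost G) (S.kindSet G s p.1) (S.kindSet G s p.2) U)
  rw [card_interedges_comm _ (S.kindSet G s p.1) (S.kindSet G s p.2 ∩ U)] at hsplit
  have hlost' : 2 * (D : ℝ) * Fintype.card V < S.lostCount G s p.1 p.2 := mod_cast hlost
  push_cast at hsplit
  rify
  linarith [hused hab, hused hba]

lemma exists_gadget_of_not_heavyTowards (hS : S.IsCalibrated G d t D c δ s η)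
    (hU : S.IsGadgetUnion G s t U g) (hg : g ≤ S.demand G s D d)
    (hgp : g p < S.demand G s D d p) (hp : ¬ HeavyTowards p.1 p.2)
    (hgdemand : ∀ q, g q ≤ S.demand G s D d p) :
    ∃ v Y B, S.IsGadget G s t p v Y B ∧ Disjoint (insert v Y ∪ B) U := by
  have hpos : 0 < S.demand G s D d p := Nat.zero_lt_of_lt hgp
  obtain ⟨v, hv, hD⟩ := exists_le_card_neighborFinset_inter <|
    hS.lt_card_interedges_sdiff hU hgdemand hp (not_heavyTowards_of_demand_pos hpos hp)
      (lt_lostCount_of_demand_pos hpos hp)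
  rw [mem_sdiff, mem_kindSet] at hv
  have hkind {u : V} (hu : u ∈ (S.lost G).neighborFinset v ∩ (S.kindSet G s p.2 \ U)) :
      S.kind G s u = p.2 := mem_kindSet.1 (mem_sdiff.1 (mem_inter.1 hu).2).1
  exact hS.exists_gadget_of_leaves hU hg hv.1 hv.2 hD
    (disjoint_left.2 fun u hu => (mem_sdiff.1 (mem_inter.1 hu).2).2)
    (fun u hu => lab_eq_of_kind_eq (hkind hu)) inter_subset_left
    fun u hu => .inr ⟨hkind hu, hp⟩

end LightCentre

/-- The gadgets are placed in the order of increasing demand of their pairs, those with heavy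
centres last. -/
lemma exists_isGadgetUnion (hS : S.IsCalibrated G d t D c δ s η) :
    ∃ U, S.IsGadgetUnion G s t U (S.demand G s D d) := by
  let rank (q : Kind ι × Kind ι) : WithTop ℕ :=
    if HeavyTowards q.1 q.2 then ⊤ else S.demand G s D d q
  refine greedy_induction (Q := fun g => ∃ U, S.IsGadgetUnion G s t U g) rank ⟨∅, .empty⟩ ?_
  rintro g p ⟨U, hU⟩ hg hgp hrank
  have hgadget : ∃ v Y B, S.IsGadget G s t p v Y B ∧ Disjoint (insert v Y ∪ B) U := by
    by_cases hp : HeavyTowards p.1 p.2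
    · exact hS.exists_gadget_of_heavyTowards hU hg hgp hp
    · refine hS.exists_gadget_of_not_heavyTowards hU hg hgp hp fun q => ?_
      by_cases hq : rank p < rank q
      · exact (hrank q hq).trans_le (Nat.zero_le _)
      · have hpq : rank q ≤ S.demand G s D d p := by simpa [rank, hp] using hq
        have hdemand : (S.demand G s D d q : WithTop ℕ) ≤ rank q := by
          simp only [rank]
          split_ifs
          · exact le_top
          · exact le_rfl
        exact (hg q).trans (WithTop.coe_le_coe.1 (hdemand.trans hpq))
  obtain ⟨v, Y, B, hp, hdisj⟩ := hgadget
  exact ⟨_, hU.add hp hdisj⟩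

end IsCalibrated

section Balancing

variable {V ι : Type*} [Fintype V] {S : Labelling V ι} {G : SimpleGraph V} {i : ι}

lemma sum_sideSign_lab_compl (U : Finset V) : ∑ v ∈ Uᶜ, sideSign i (S.lab v) =
    #{v ∈ S.cluster i \ U | S.side v = true} - #{v ∈ S.cluster i \ U | S.side v = false} := by
  have hside (b : Bool) : {v ∈ S.cluster i \ U | S.side v = b} =
      ({v ∈ Uᶜ | S.cl v = i ∧ S.side v = b} : Finset V) := by
    ext v
    simp only [mem_filter, mem_sdiff, mem_cluster, mem_compl]
    tauto
  rw [hside, hside, ← sum_boole, ← sum_boole, ← sum_sub_distrib]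
  refine sum_congr rfl fun v _ => ?_
  unfold sideSign lab
  by_cases hv : S.cl v = i <;> cases S.side v <;> simp [hv]

lemma exists_subset_card_filter_sdiff_eq {α : Type*} (Z : Finset α) (f : α → Bool) {C : ℝ}
    (hC : |(#{v ∈ Z | f v = true} : ℝ) - #{v ∈ Z | f v = false}| ≤ C) :
    ∃ X ⊆ Z, (#X : ℝ) ≤ C ∧ #{v ∈ Z \ X | f v = true} = #{v ∈ Z \ X | f v = false} := by
  have htrim {b b' : Bool} (hb : b ≠ b') (hle : #{v ∈ Z | f v = b'} ≤ #{v ∈ Z | f v = b}) :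
      ∃ X ⊆ Z, #X = #{v ∈ Z | f v = b} - #{v ∈ Z | f v = b'} ∧
        #{v ∈ Z \ X | f v = b} = #{v ∈ Z \ X | f v = b'} := by
    obtain ⟨X, hXb, hX⟩ := exists_subset_card_eq
      (Nat.sub_le #{v ∈ Z | f v = b} #{v ∈ Z | f v = b'})
    have hdisj : Disjoint {v ∈ Z | f v = b'} X := disjoint_left.2 fun v hv hvX =>
      hb ((mem_filter.1 (hXb hvX)).2.symm.trans (mem_filter.1 hv).2)
    refine ⟨X, hXb.trans (filter_subset _ _), hX, ?_⟩
    have hfilter (b : Bool) : {v ∈ Z \ X | f v = b} = {v ∈ Z | f v = b} \ X := by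
      grind
    rw [hfilter, hfilter, card_sdiff_of_subset hXb, hX,
      sdiff_eq_self_of_disjoint hdisj, Nat.sub_sub_self hle]
  rcases le_total #{v ∈ Z | f v = false} #{v ∈ Z | f v = true} with hle | hle
  · obtain ⟨X, hXZ, hX, heq⟩ := htrim Bool.true_eq_false.mp hle
    refine ⟨X, hXZ, ?_, heq⟩
    rw [hX, Nat.cast_sub hle]
    exact (le_abs_self _).trans hC
  · obtain ⟨X, hXZ, hX, heq⟩ := htrim Bool.false_ne_true hle
    refine ⟨X, hXZ, ?_, heq.symm⟩
    rw [hX, Nat.cast_sub hle]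
    exact (le_abs_self _).trans (abs_sub_comm (α := ℝ) _ _ ▸ hC)

variable [Fintype ι] {s : ℝ} {d : ℕ}

lemma mul_sum_sideSign_eq (hG : ∀ v, G.degree v = d) (hi : i ∈ S.bip) :
    d * ∑ v, sideSign i (S.lab v) = ∑ p : Kind ι × Kind ι,
      share p.1 p.2 * S.lostCount G s p.1 p.2 * (sideSign i p.1.1 + sideSign i p.2.1) := by
  have hkind (a : Kind ι) : ∑ v with S.kind G s v = a,
      sideSign i (S.lab v) * ((S.lost G).degree v : ℝ) =
        ∑ b, sideSign i a.1 * S.lostCount G s a b := by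
    rw [← mul_sum, ← Nat.cast_sum, sum_lostCount, Nat.cast_sum, mul_sum]
    refine sum_congr rfl fun v hv => ?_
    rw [lab_eq_of_kind_eq (mem_filter.1 hv).2]
  have hshare (a b : Kind ι) : sideSign i a.1 * (S.lostCount G s a b : ℝ) =
      share a b * S.lostCount G s a b * sideSign i a.1 +
        share b a * S.lostCount G s b a * sideSign i a.1 := by
    rw [lostCount_comm b a, ← add_mul, ← add_mul, share_add_share, one_mul, mul_comm]
  calc d * ∑ v, sideSign i (S.lab v)
      = ∑ a, ∑ b, sideSign i a.1 * (S.lostCount G s a b : ℝ) := by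
        rw [← sum_sideSign_mul_degree_lost hG hi, ← sum_fiberwise univ (S.kind G s)]
        exact sum_congr rfl fun a _ => hkind a
    _ = ∑ a, ∑ b, share a b * S.lostCount G s a b * (sideSign i a.1 + sideSign i b.1) := by
        simp only [hshare, mul_add, sum_add_distrib]
        congr 1
        exact sum_comm
    _ = _ := (Fintype.sum_prod_type' fun a b : Kind ι =>
          share a b * S.lostCount G s a b * (sideSign i a.1 + sideSign i b.1)).symm

namespace IsCalibrated

variable [Nonempty V] {t D : ℕ} {c δ η : ℝ} {U : Finset V}

lemma abs_sum_sideSign_compl_le (hS : S.IsCalibrated G d t D c δ s η)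
    (hU : S.IsGadgetUnion G s t U (S.demand G s D d)) (hi : i ∈ S.bip) :
    |∑ v ∈ Uᶜ, sideSign i (S.lab v)| ≤
      Fintype.card (Kind ι × Kind ι) * (2 * (2 * D / c + 1)) := by
  have htotal : ∑ v, sideSign i (S.lab v) = ∑ p : Kind ι × Kind ι,
      share p.1 p.2 * S.lostCount G s p.1 p.2 / d * (sideSign i p.1.1 + sideSign i p.2.1) := by
    rw [eq_div_of_mul_eq hS.degree_pos.ne'
      ((mul_comm _ _).trans (mul_sum_sideSign_eq (s := s) hS.degree_eq hi)), sum_div]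
    exact sum_congr rfl fun p _ => by ring
  have hcompl : ∑ v ∈ Uᶜ, sideSign i (S.lab v) = ∑ p : Kind ι × Kind ι,
      (share p.1 p.2 * S.lostCount G s p.1 p.2 / d - S.demand G s D d p) *
        (sideSign i p.1.1 + sideSign i p.2.1) := by
    simp_rw [sub_mul]
    rw [sum_sub_distrib, ← htotal, ← hU.sum_sideSign hS.one_le hi, ← sum_add_sum_compl U]
    ring
  have hterm (p : Kind ι × Kind ι) :
      |(share p.1 p.2 * S.lostCount G s p.1 p.2 / d - S.demand G s D d p) *
        (sideSign i p.1.1 + sideSign i p.2.1)| ≤ 2 * (2 * D / c + 1) := by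
    have hle := demand_le (S := S) (G := G) (s := s) (D := D) (d := d) p
    have hge := le_demand_add (S := S) (G := G) (s := s) (D := D) hS.c_pos hS.le_degree p
    have hsign : |sideSign i p.1.1 + sideSign i p.2.1| ≤ 2 := (abs_add_le _ _).trans <| by
      linarith [abs_sideSign_le_one i p.1.1, abs_sideSign_le_one i p.2.1]
    rw [abs_mul, abs_of_nonneg (sub_nonneg.2 hle), mul_comm]
    gcongr
    linarith
  rw [hcompl, ← nsmul_eq_mul]
  exact (abs_sum_le_sum_abs _ _).trans (sum_le_card_nsmul _ _ _ fun p _ => hterm p)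

lemma exists_balanced (hS : S.IsCalibrated G d t D c δ s η) : ∃ L X : Finset V,
    (#X : ℝ) ≤ Fintype.card ι * (Fintype.card (Kind ι × Kind ι) * (2 * (2 * D / c + 1))) ∧
    (#L : ℝ) ≤ 2 * t * (η / c * Fintype.card V) ∧
    HasPackingOn (completeBipartiteGraph (Fin t) (Fin t)) G L ∧
    ∀ i ∈ S.bip, #{v ∈ S.cluster i \ (L ∪ X) | S.side v = true} =
      #{v ∈ S.cluster i \ (L ∪ X) | S.side v = false} := by
  obtain ⟨U, hU⟩ := hS.exists_isGadgetUnion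
  have htrim (i : ι) : ∃ X ⊆ S.cluster i \ U,
      (#X : ℝ) ≤ Fintype.card (Kind ι × Kind ι) * (2 * (2 * D / c + 1)) ∧
      (i ∈ S.bip → #{v ∈ (S.cluster i \ U) \ X | S.side v = true} =
        #{v ∈ (S.cluster i \ U) \ X | S.side v = false}) := by
    by_cases hi : i ∈ S.bip
    · have himbalance := hS.abs_sum_sideSign_compl_le hU hi
      rw [sum_sideSign_lab_compl] at himbalance
      obtain ⟨X, hXsub, hX, heq⟩ := exists_subset_card_filter_sdiff_eq _ _ himbalance
      exact ⟨X, hXsub, hX, fun _ => heq⟩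
    · have _ := hS.c_pos
      refine ⟨∅, empty_subset _, ?_, fun h => absurd h hi⟩
      rw [card_empty, Nat.cast_zero]
      positivity
  choose X hXsub hX heq using htrim
  have hsdiff (i : ι) : S.cluster i \ (U ∪ univ.biUnion X) = (S.cluster i \ U) \ X i := by
    ext v
    have hmem (j : ι) (hv : v ∈ X j) : S.cl v = j :=
      mem_cluster.1 (mem_sdiff.1 (hXsub j hv)).1
    simp only [mem_sdiff, mem_cluster, mem_union, mem_biUnion, mem_univ, true_and]
    grind
  refine ⟨U, univ.biUnion X, ?_, hS.card_le hU le_rfl, hU.hasPackingOn hS.one_le,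
    fun i hi => ?_⟩
  · rw [← nsmul_eq_mul]
    exact (Nat.cast_le.2 card_biUnion_le).trans <| (Nat.cast_sum _ _).trans_le <|
      sum_le_card_nsmul _ _ _ fun i _ => hX i
  · rw [hsdiff]
    exact heq i hi

end IsCalibrated

end Balancing

lemma exists_isCalibrated (ι : Type*) [Fintype ι] {c δ : ℝ} (hc : 0 < c) (hδ : 0 < δ) {t : ℕ}
    (ht : 2 ≤ t) : ∃ (D N : ℕ) (s θ : ℝ), 0 < θ ∧
      ∀ (V : Type u) [Fintype V] (G : SimpleGraph V) (d : ℕ) (S : Labelling V ι) (η : ℝ),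
        N ≤ Fintype.card V → (∀ v, G.degree v = d) → c * Fintype.card V ≤ d → η ≤ θ →
        S.IsGood G η δ → S.IsCalibrated G d t D c δ s η := by
  have htpos : (0 : ℝ) < t := Nat.cast_pos.2 (two_pos.trans_le ht)
  obtain ⟨D, hD⟩ := exists_nat_ge (4 * (t : ℝ) / δ)
  rw [div_le_iff₀' hδ] at hD
  obtain ⟨s, hs, hsc, hscδ, hsδ⟩ : ∃ s : ℝ, 0 < s ∧
      s ≤ c / (4 * t * (Fintype.card (Kind ι × Kind ι) + 1)) ∧
      s ≤ c * δ / (2 * t * (Fintype.card (Kind ι) + 1)) ∧ s ≤ δ / 2 :=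
    ⟨min (c / (4 * t * (Fintype.card (Kind ι × Kind ι) + 1)))
        (min (c * δ / (2 * t * (Fintype.card (Kind ι) + 1))) (δ / 2)), by positivity,
      min_le_left _ _, (min_le_right _ _).trans (min_le_left _ _),
      (min_le_right _ _).trans (min_le_right _ _)⟩
  rw [le_div_iff₀ (by positivity)] at hsc hscδ
  obtain ⟨N, hN⟩ := exists_nat_ge (max ((t : ℝ) * 2 ^ (D + 2) / δ) (2 * ((D : ℝ) + 1) / s))
  rw [max_le_iff, div_le_iff₀' hδ, div_le_iff₀' hs] at hN
  refine ⟨D, N, s, s / (2 * (2 * t / c + 1 / s)), by positivity, ?_⟩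
  intro V _ G d S η hNV hG hd hη hS
  have hNV' : (N : ℝ) ≤ Fintype.card V := Nat.cast_le.2 hNV
  refine
    { c_pos := hc, δ_pos := hδ, s_pos := hs, two_le := ht, degree_eq := hG, le_degree := hd
      isGood := hS, four_mul_le := hD, s_le_half_δ := hsδ
      mul_pow_le := hN.1.trans (mul_le_mul_of_nonneg_left hNV' hδ.le)
      mul_s_le_c := ?_, mul_s_le_c_mul_δ := ?_, room := ?_ }
  · linarith [mul_pos (mul_pos four_pos htpos) hs]
  · linarith [mul_pos (mul_pos two_pos htpos) hs]
  · have hηs : η * (2 * t / c + 1 / s) ≤ s / 2 := by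
      rw [le_div_iff₀ (by positivity)] at hη
      linarith
    have hDN := hN.2.trans (mul_le_mul_of_nonneg_left hNV' hs.le)
    calc 2 * t * (η / c * Fintype.card V) + η / s * Fintype.card V + D + 1
        = η * (2 * t / c + 1 / s) * Fintype.card V + (D + 1) := by ring
      _ ≤ s / 2 * Fintype.card V + s / 2 * Fintype.card V := by
          gcongr
          linarith
      _ = s * Fintype.card V := by ring

lemma exists_balanced (ι : Type*) [Finite ι] {c δ : ℝ} (hc : 0 < c) (hδ : 0 < δ) {t : ℕ}
    (ht : 2 ≤ t) : ∃ C : ℝ, ∃ θ > (0 : ℝ), ∃ N : ℕ,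
      ∀ (V : Type u) [Fintype V] [Nonempty V] (G : SimpleGraph V) (d : ℕ) (S : Labelling V ι)
        (η : ℝ), N ≤ Fintype.card V → (∀ v, G.degree v = d) → c * Fintype.card V ≤ d → η ≤ θ →
        S.IsGood G η δ → ∃ L X : Finset V, (#X : ℝ) ≤ C ∧
          (#L : ℝ) ≤ 2 * t * (η / c * Fintype.card V) ∧
          HasPackingOn (completeBipartiteGraph (Fin t) (Fin t)) G L ∧
          ∀ i ∈ S.bip, #{v ∈ S.cluster i \ (L ∪ X) | S.side v = true} =
            #{v ∈ S.cluster i \ (L ∪ X) | S.side v = false} := by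
  have := Fintype.ofFinite ι
  obtain ⟨D, N, s, θ, hθ, hcal⟩ := exists_isCalibrated ι hc hδ ht
  exact ⟨_, θ, hθ, N, fun V _ _ G d S η hNV hG hd hη hS =>
    (hcal V G d S η hNV hG hd hη hS).exists_balanced⟩

end Labelling

section Deletion

variable {V : Type*} {H : SimpleGraph V} {Z M : Finset V}

lemma card_interedges_le_add_mul {A B C : Finset V} (hC : C ⊆ B ∪ M) :
    #(H.interedges A C) ≤ #(H.interedges A B) + #A * #M := by
  have hcover : H.interedges A C ⊆ H.interedges A B ∪ A ×ˢ M := by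
    rintro ⟨x, y⟩ hxy
    have hy := @hC y
    simp only [mem_union, SimpleGraph.mem_interedges_iff, mem_product] at hxy hy ⊢
    tauto
  exact (card_le_card hcover).trans <| (card_union_le _ _).trans_eq <| by rw [card_product]

lemma NoSparseCuts.induce_sdiff {α ζ μ : ℝ} (h : NoSparseCuts (H.induce (Z : Set V)) α)
    (hζ : 0 ≤ ζ) (hα : ζ + 2 * μ ≤ α) (hM : (#M : ℝ) ≤ μ * #(Z \ M)) :
    NoSparseCuts (H.induce ((Z \ M : Finset V) : Set V)) ζ := by
  rw [noSparseCuts_induce_iff] at h ⊢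
  have hcut {A B : Finset V} (hA : A.Nonempty) (hB : B.Nonempty) (hdisj : Disjoint A B)
      (hAB : A ∪ B = Z \ M) (hle : #A ≤ #B) : ζ * #A * #B < #(H.interedges A B) := by
    have hAZ : A ⊆ Z := (subset_union_left.trans hAB.subset).trans sdiff_subset
    have hBZ : B ⊆ Z \ A := fun v hv => mem_sdiff.2
      ⟨(mem_sdiff.1 (hAB.subset (mem_union_right A hv))).1, disjoint_right.1 hdisj hv⟩
    have hZA : Z \ A ⊆ B ∪ M := by
      refine sdiff_le_iff.2 ?_
      rw [sup_eq_union, ← union_assoc, hAB, sdiff_union_self_eq_union]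
      exact subset_union_left
    have hsum : (#(Z \ M) : ℝ) = #A + #B := by
      rw [← hAB, card_union_of_disjoint hdisj, Nat.cast_add]
    have hBpos : (0 : ℝ) < #B := Nat.cast_pos.2 hB.card_pos
    have hle' : (#A : ℝ) ≤ #B := Nat.cast_le.2 hle
    have hμ : 0 ≤ μ := nonneg_of_mul_nonneg_left ((Nat.cast_nonneg _).trans hM) (by linarith)
    have hdel : (#(H.interedges A (Z \ A)) : ℝ) ≤ #(H.interedges A B) + #A * #M :=
      mod_cast card_interedges_le_add_mul hZA
    have hMB : (#M : ℝ) ≤ μ * (2 * #B) := hM.trans (by gcongr; linarith)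
    have hα₀ : 0 ≤ α := by linarith
    have hlow : (ζ + 2 * μ) * #A * #B < #(H.interedges A (Z \ A)) :=
      lt_of_le_of_lt (by gcongr) (h A hAZ hA (hB.mono hBZ))
    have hAM : (#A : ℝ) * #M ≤ #A * (μ * (2 * #B)) := by gcongr
    linarith
  intro A hAZ hA hB
  rcases le_total #A #((Z \ M) \ A) with hle | hle
  · exact hcut hA hB disjoint_sdiff (union_sdiff_of_subset hAZ) hle
  · rw [card_interedges_comm, mul_right_comm]
    exact hcut hB hA sdiff_disjoint (sdiff_union_of_subset hAZ) hle

lemma IsFarFromBipartite.comap {W W' : Type*} [Fintype W] {H : SimpleGraph W} {m : ℝ}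
    (h : IsFarFromBipartite H m) (f : W' ↪ W) {M : Finset W} (hM : ∀ w ∉ M, w ∈ Set.range f) :
    IsFarFromBipartite (H.comap f) (m - #M * Fintype.card W) := by
  rintro E hE ⟨φ⟩
  have := Finite.of_injective f f.injective
  let T : Finset (Sym2 W) := M.biUnion fun w => H.incidenceFinset w
  have hT : #T ≤ #M * Fintype.card W := card_biUnion_le_card_mul _ _ _ fun w _ => by
    rw [SimpleGraph.card_incidenceFinset_eq_degree]
    exact degree_le_card H w
  have hmT {x y : W} (hxy : H.Adj x y) (hx : s(x, y) ∉ T) : x ∈ Set.range f :=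
    hM x fun hxM => hx (mem_biUnion.2 ⟨x, hxM, by simpa using hxy⟩)
  have hcol : (H.deleteEdges (Sym2.map f '' E ∪ T)).IsBipartite := by
    refine ⟨SimpleGraph.Coloring.mk (Function.extend f φ fun _ => 0) ?_⟩
    intro x y hxy
    rw [SimpleGraph.deleteEdges_adj, Set.mem_union, not_or] at hxy
    obtain ⟨hadj, hnot, hnotT⟩ := hxy
    obtain ⟨x, rfl⟩ := hmT hadj hnotT
    obtain ⟨y, rfl⟩ := hmT hadj.symm (Sym2.eq_swap ▸ hnotT)
    rw [f.injective.extend_apply, f.injective.extend_apply]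
    refine φ.valid ?_
    rw [SimpleGraph.deleteEdges_adj]
    exact ⟨hadj, fun hmem => hnot ⟨_, hmem, rfl⟩⟩
  have hsub : Sym2.map f '' E ∪ T ⊆ H.edgeSet := by
    rintro e (⟨e, he, rfl⟩ | he)
    · induction e using Sym2.ind with
      | _ x y => exact hE he
    · obtain ⟨w, -, hw⟩ := mem_biUnion.1 he
      exact H.incidenceSet_subset w (by simpa using hw)
  have hcard : ((Sym2.map f '' E ∪ T).ncard : ℝ) ≤ E.ncard + #M * Fintype.card W := by
    refine mod_cast (Set.ncard_union_le _ _).trans (add_le_add (Set.ncard_image_le E.toFinite) ?_)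
    rwa [Set.ncard_coe_finset]
  linarith [h _ hsub hcol]

lemma IsFarFromBipartite.induce_sdiff [Fintype V] {m m' : ℝ}
    (h : IsFarFromBipartite (H.induce (Z : Set V)) m)
    (hm : m' + #M * (Fintype.card V : ℝ) ≤ m) :
    IsFarFromBipartite (H.induce ((Z \ M : Finset V) : Set V)) m' := by
  intro E hE hbip
  have hsub : ((Z \ M : Finset V) : Set V) ⊆ Z := coe_subset.2 sdiff_subset
  have hrange : ∀ w ∉ ({w | w.1 ∈ M} : Finset (Z : Set V)),
      w ∈ Set.range (Set.embeddingOfSubset _ _ hsub) := fun w hw =>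
    ⟨⟨w, mem_coe.2 (mem_sdiff.2 ⟨w.2, by simpa using hw⟩)⟩, rfl⟩
  have hcard : #({w | w.1 ∈ M} : Finset (Z : Set V)) * Fintype.card (Z : Set V) ≤
      #M * Fintype.card V :=
    Nat.mul_le_mul
      (card_le_card_of_injOn Subtype.val (fun w hw => (mem_filter.1 hw).2)
        Subtype.val_injective.injOn)
      (Fintype.card_subtype_le _)
  have hcard' : (#({w | w.1 ∈ M} : Finset (Z : Set V)) : ℝ) * Fintype.card (Z : Set V) ≤
      #M * Fintype.card V := mod_cast hcard
  linarith [h.comap _ hrange E hE hbip]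

lemma averageDegree_induce :
    averageDegree (H.induce (Z : Set V)) = #(H.interedges Z Z) / #Z := by
  have hsum : ∑ v, (H.induce (Z : Set V)).degree v = #(H.interedges Z Z) :=
    calc ∑ v, (H.induce (Z : Set V)).degree v
        = ∑ v, #((H.induce (Z : Set V)).neighborFinset v ∩ univ) := by
          simp only [inter_univ, SimpleGraph.card_neighborFinset_eq_degree]
      _ = #((H.comap (Function.Embedding.subtype (· ∈ (Z : Set V)))).interedges univ univ) := by
          convert (card_interedges_eq_sum (H.induce (Z : Set V)) univ univ).symm
      _ = #(H.interedges Z Z) := by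
          rw [card_interedges_comap]
          congr 2 <;> (ext v; simp)
  unfold averageDegree
  rw [← hsum, Nat.cast_sum]
  congr! 2
  simp

end Deletion

namespace Labelling

variable {V ι : Type*} [Fintype V] {S : Labelling V ι} {G : SimpleGraph V} {i : ι}

lemma isBalancedBipartite_induce_kept (hi : i ∈ S.bip) {Z : Finset V} (hZ : Z ⊆ S.cluster i)
    (hcard : #{v ∈ Z | S.side v = true} = #{v ∈ Z | S.side v = false}) :
    IsBalancedBipartite ((S.kept G).induce (Z : Set V)) := by
  have hncard (b : Bool) :
      ({x | S.side x.1 = b} : Set (Z : Set V)).ncard = #{v ∈ Z | S.side v = b} := by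
    rw [← Set.ncard_image_of_injective _ Subtype.val_injective, ← Set.ncard_coe_finset]
    congr 1
    ext v
    simp [and_comm]
  refine ⟨{x | S.side x.1 = true}, {x | S.side x.1 = false}, ⟨?_, ?_⟩, ?_, ?_⟩
  · refine Set.disjoint_left.2 fun x hx hx' => ?_
    exact Bool.false_ne_true (hx'.symm.trans hx)
  · intro x y hxy
    have hside : S.side x.1 ≠ S.side y.1 := hxy.2.2 ((mem_cluster.1 (hZ x.2)).symm ▸ hi)
    simp only [Set.mem_ofPred_eq]
    grind
  · ext x
    simp
  · rw [hncard, hncard, hcard]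

namespace IsGood

variable {η δ κ μ : ℝ} {d : ℕ} {M : Finset V}

lemma le_card_cluster_sdiff (hS : S.IsGood G η δ) (hi : i ∈ S.indices)
    (hM : (#M : ℝ) ≤ (δ - κ) * Fintype.card V) :
    κ * Fintype.card V ≤ #(S.cluster i \ M) := by
  have hsdiff : (#(S.cluster i) : ℝ) ≤ #(S.cluster i \ M) + #M := mod_cast
    Nat.sub_le_iff_le_add.1 (le_card_sdiff M (S.cluster i))
  linarith [hS.le_card_cluster hi]

lemma le_card_interedges_cluster_sdiff (hS : S.IsGood G η δ) (hG : ∀ v, G.degree v = d) (i : ι)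
    (M : Finset V) : #(S.cluster i \ M) * (d - #M : ℝ) - η * (Fintype.card V : ℝ) ^ 2 ≤
      #((S.kept G).interedges (S.cluster i \ M) (S.cluster i \ M)) := by
  have hdeg {v : V} (hv : v ∈ S.cluster i \ M) : (d - #M : ℝ) - (S.lost G).degree v ≤
      #((S.kept G).neighborFinset v ∩ (S.cluster i \ M)) := by
    have hsplit : (S.kept G).neighborFinset v ⊆
        (S.kept G).neighborFinset v ∩ (S.cluster i \ M) ∪ M := by
      intro u hu
      have := neighborSet_kept_subset_cluster (mem_sdiff.1 hv).1
        ((SimpleGraph.mem_neighborFinset _ _ _).1 hu)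
      grind
    have hkept := (card_le_card hsplit).trans (card_union_le _ _)
    have hadd := S.degree_kept_add_degree_lost G v
    rw [SimpleGraph.card_neighborFinset_eq_degree] at hkept
    rw [hG] at hadd
    rify at hkept hadd
    linarith
  have hlost : ∑ v ∈ S.cluster i \ M, ((S.lost G).degree v : ℝ) ≤
      η * (Fintype.card V : ℝ) ^ 2 :=
    (sum_le_sum_of_subset_of_nonneg (subset_univ _) fun _ _ _ => Nat.cast_nonneg _).trans
      hS.sum_degree_lost_le
  rw [card_interedges_eq_sum, Nat.cast_sum]
  refine le_trans ?_ (sum_le_sum fun v hv => hdeg hv)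
  rw [sum_sub_distrib, sum_const, nsmul_eq_mul]
  linarith

lemma le_averageDegree [Nonempty V] (hS : S.IsGood G η δ) (hG : ∀ v, G.degree v = d)
    (hκ : 0 < κ) (hM : (#M : ℝ) ≤ μ * Fintype.card V)
    (hZ : κ * Fintype.card V ≤ #(S.cluster i \ M)) :
    d - (μ / κ + η / κ ^ 2) * #(S.cluster i \ M) ≤
      averageDegree ((S.kept G).induce ((S.cluster i \ M : Finset V) : Set V)) := by
  have hn : (0 : ℝ) < Fintype.card V := Nat.cast_pos.2 Fintype.card_pos
  have hη := hS.nonneg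
  have hμ : 0 ≤ μ := nonneg_of_mul_nonneg_left ((Nat.cast_nonneg _).trans hM) hn
  have hZpos : (0 : ℝ) < #(S.cluster i \ M) := (mul_pos hκ hn).trans_le hZ
  have hcard : (Fintype.card V : ℝ) ≤ #(S.cluster i \ M) / κ := (le_div_iff₀' hκ).2 hZ
  have hMZ : (#M : ℝ) ≤ μ * (#(S.cluster i \ M) / κ) := hM.trans (by gcongr)
  rw [averageDegree_induce, le_div_iff₀ hZpos]
  calc (d - (μ / κ + η / κ ^ 2) * #(S.cluster i \ M)) * #(S.cluster i \ M)
      = #(S.cluster i \ M) * (d - μ * (#(S.cluster i \ M) / κ)) -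
          η * (#(S.cluster i \ M) / κ) ^ 2 := by ring
    _ ≤ #(S.cluster i \ M) * (d - #M : ℝ) - η * (Fintype.card V : ℝ) ^ 2 := by gcongr
    _ ≤ _ := hS.le_card_interedges_cluster_sdiff hG i M

end IsGood

end Labelling

section Constants

lemma IsHierarchyFunction.one_div_le {f : ℝ → ℝ} (hf : IsHierarchyFunction f) {x y : ℝ}
    (hx : x ∈ Set.Ioc 0 1) (hxy : x ≤ y) (hy : y ≤ 1) {n : ℕ} (hn : ⌈1 / f x⌉₊ ≤ n) :
    1 / (n : ℝ) ≤ f y := by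
  have hfx : 0 < f x := (hf.mapsTo hx).1
  have hinv : 1 / f x ≤ n := (Nat.le_ceil _).trans (Nat.cast_le.2 hn)
  exact (_root_.one_div_le ((one_div_pos.2 hfx).trans_le hinv) hfx).2 hinv |>.trans <|
    hf.monotoneOn hx ⟨hx.1.trans_le hxy, hy⟩ hxy

/-- The scale `(η, ζ, γ)` is a hierarchy `b * η ≪ ζ ≪ γ ≪ u` as prescribed by `f₁` and `f₂`, and
its entries are small compared with the remaining constants. The factor `b` is there because the
parts of the final decomposition lose `b` times as many edges as the labelling they come from. -/
structure IsHierarchy (f₁ f₂ : ℝ → ℝ) (u a b κ θ C η ζ γ : ℝ) : Prop where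
  mul_eta_le_apply : b * η ≤ f₁ ζ
  zeta_le_apply : ζ ≤ f₂ γ
  gamma_le : γ ≤ u
  mul_eta_le_mul_zeta : a * η ≤ κ * ζ
  mul_eta_le_gamma : a * η ≤ γ
  mul_eta_le : a * η ≤ κ
  eta_le : η ≤ θ
  zeta_le : ζ ≤ 1 / 4
  const_mul_zeta_le : C * ζ ≤ 16

open Filter Topology in
lemma exists_isHierarchy {f₁ f₂ : ℝ → ℝ} (hf₁ : IsHierarchyFunction f₁)
    (hf₂ : IsHierarchyFunction f₂) {u a b κ θ C : ℝ} (hu : 0 < u) (hκ : 0 < κ) (hθ : 0 < θ)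
    {e : ℝ} (he : 0 < e) : ∃ η ζ γ : ℝ, 0 < η ∧ 0 < ζ ∧ 0 < γ ∧ η ≤ e ∧ ζ ≤ e ∧ γ ≤ e ∧
      IsHierarchy f₁ f₂ u a b κ θ C η ζ γ := by
  have hmul {x : ℝ} (y : ℝ) (hx : 0 < x) : ∀ᶠ z in 𝓝[>] (0 : ℝ), y * z ≤ x :=
    nhdsWithin_le_nhds <| ((continuous_const_mul y).tendsto' 0 0 (mul_zero y)).eventually
      (Iic_mem_nhds hx)
  have hle {x : ℝ} (hx : 0 < x) : ∀ᶠ z in 𝓝[>] (0 : ℝ), z ≤ x :=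
    nhdsWithin_le_nhds (Iic_mem_nhds hx)
  have hpos : ∀ᶠ z in 𝓝[>] (0 : ℝ), 0 < z := eventually_mem_nhdsWithin
  obtain ⟨γ, hγ, hγe, hγu, hγ1⟩ :=
    (hpos.and <| (hle he).and <| (hle hu).and (hle one_pos)).exists
  obtain ⟨ζ, hζ, hζe, hζf, hζ4, hζC⟩ :=
    (hpos.and <| (hle he).and <| (hle (hf₂.mapsTo ⟨hγ, hγ1⟩).1).and <|
      (hle (by norm_num : (0 : ℝ) < 1 / 4)).and (hmul C (by norm_num : (0 : ℝ) < 16))).exists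
  have hζ1 : ζ ∈ Set.Ioc (0 : ℝ) 1 := ⟨hζ, hζ4.trans (by norm_num)⟩
  obtain ⟨η, hη, hηe, hηf, hηζ, hηγ, hηκ, hηθ⟩ :=
    (hpos.and <| (hle he).and <| (hmul b (hf₁.mapsTo hζ1).1).and <|
      (hmul a (mul_pos hκ hζ)).and <| (hmul a hγ).and <| (hmul a hκ).and (hle hθ)).exists
  exact ⟨η, ζ, γ, hη, hζ, hγ, hηe, hζe, hγe, hηf, hζf, hγu, hηζ, hηγ, hηκ, hηθ, hζ4, hζC⟩

lemma sixteen_div_le_mul_exp_div_pow {c ζ : ℝ} (hc : 0 < c) (hc₁ : c ≤ 1) (hζ : 0 < ζ)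
    (hζ₄ : ζ ≤ 1 / 4) {t r : ℕ} (ht : 0 < t) (hr : 0 < r) :
    16 / ζ ≤ 64 * (r : ℝ) ^ 2 * ((t : ℝ) / c) * (Real.exp 1 / (8 * ζ)) ^ t := by
  have hexp : 1 / (4 * ζ) ≤ Real.exp 1 / (8 * ζ) := by
    rw [div_le_div_iff₀ (by positivity) (by positivity)]
    nlinarith [Real.add_one_le_exp (1 : ℝ)]
  have hone : 1 ≤ 1 / (4 * ζ) := (one_le_div (by positivity)).2 (by linarith)
  have hpow : Real.exp 1 / (8 * ζ) ≤ (Real.exp 1 / (8 * ζ)) ^ t :=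
    le_self_pow₀ (hone.trans hexp) ht.ne'
  have htc : (1 : ℝ) ≤ t / c := (one_le_div hc).2 (hc₁.trans (mod_cast ht))
  have hr2 : (1 : ℝ) ≤ (r : ℝ) ^ 2 := one_le_pow₀ (mod_cast hr)
  calc 16 / ζ = 64 * 1 * 1 * (1 / (4 * ζ)) := by field_simp; norm_num
    _ ≤ 64 * (r : ℝ) ^ 2 * (t / c) * (Real.exp 1 / (8 * ζ)) ^ t := by
        gcongr
        exact hexp.trans hpow

end Constants

namespace Labelling

section Single

variable {V ι : Type*} {G : SimpleGraph V} {i : ι}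

/-- The labelling with a single cluster, not marked as bipartite. -/
def single (V : Type*) (i : ι) : Labelling V ι := ⟨fun _ => i, fun _ => true, ∅⟩

lemma kept_single : (single V i).kept G = G := by
  ext u v
  simp [kept, single]

variable [Fintype V]

lemma isGood_single {η δ : ℝ} (hη : 0 ≤ η) (hG : ∀ v, δ * Fintype.card V ≤ G.degree v) :
    (single V i).IsGood G η δ := by
  have hlost (v : V) : ((single V i).lost G).degree v = 0 := by
    have := (single V i).degree_kept_add_degree_lost G v
    rw [kept_single] at this
    omega
  refine ⟨?_, fun v => ?_⟩
  · simp only [hlost, Nat.cast_zero, sum_const_zero]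
    positivity
  · rw [kept_single]
    exact hG v

end Single

section Parts

variable {V ι : Type*} [Fintype V] {S : Labelling V ι}

lemma card_indices_pos [Nonempty V] : 0 < #S.indices :=
  card_pos.2 (univ_nonempty.image _)

lemma disjoint_cluster {i j : ι} (hij : i ≠ j) : Disjoint (S.cluster i) (S.cluster j) :=
  disjoint_left.2 fun _ hi hj => hij ((mem_cluster.1 hi).symm.trans (mem_cluster.1 hj))

lemma sdiff_biUnion_cluster_subset {κ : Type*} [Fintype κ] (e : κ ≃ S.indices) (L X : Finset V) :
    univ \ (univ.biUnion (fun j => S.cluster (e j).1 \ (L ∪ X)) ∪ L) ⊆ X := by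
  intro v hv
  have hpart : v ∈ S.cluster (e (e.symm ⟨S.cl v, cl_mem_indices v⟩)).1 := by
    rw [e.apply_symm_apply, mem_cluster]
  simp only [mem_sdiff, mem_union, mem_biUnion, mem_univ, true_and, not_or, not_exists] at hv
  have := hv.1 (e.symm ⟨S.cl v, cl_mem_indices v⟩)
  tauto

/-- The clusters of a labelling, without the vertices of `L` and `X`, are the parts of a
decomposition as sought in the theorem: `G'` is `S.kept G`, the packed set is `L`, and the uncovered
vertices are in `X`. -/
structure IsDecomposition (S : Labelling V ι) (G : SimpleGraph V) (d t : ℕ) (η ζ γ : ℝ)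
    (L X : Finset V) : Prop where
  nonempty : ∀ i ∈ S.indices, (S.cluster i \ (L ∪ X)).Nonempty
  le_averageDegree : ∀ i ∈ S.indices, d - η * #(S.cluster i \ (L ∪ X)) ≤
    averageDegree ((S.kept G).induce ((S.cluster i \ (L ∪ X) : Finset V) : Set V))
  noSparseCuts : ∀ i ∈ S.indices,
    NoSparseCuts ((S.kept G).induce ((S.cluster i \ (L ∪ X) : Finset V) : Set V)) ζ
  isBalancedBipartite_or_isFarFromBipartite : ∀ i ∈ S.indices,
    IsBalancedBipartite ((S.kept G).induce ((S.cluster i \ (L ∪ X) : Finset V) : Set V)) ∨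
    IsFarFromBipartite ((S.kept G).induce ((S.cluster i \ (L ∪ X) : Finset V) : Set V))
      (γ * (Fintype.card V : ℝ) ^ 2)
  hasPackingOn : HasPackingOn (completeBipartiteGraph (Fin t) (Fin t)) G L

lemma IsGood.isDecomposition [Nonempty V] {G : SimpleGraph V} {d t : ℕ} {η δ κ μ ζ γ : ℝ}
    {L X : Finset V} (hS : S.IsGood G η δ) (hT : S.IsTerminal G (4 * ζ) (2 * γ))
    (hG : ∀ v, G.degree v = d) (hκ : 0 < κ) (hζ : 0 ≤ ζ)
    (hM : (#(L ∪ X) : ℝ) ≤ μ * Fintype.card V) (hμδ : μ ≤ δ - κ) (hμζ : μ ≤ κ * ζ) (hμγ : μ ≤ γ)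
    (hpack : HasPackingOn (completeBipartiteGraph (Fin t) (Fin t)) G L)
    (hbal : ∀ i ∈ S.bip, #{v ∈ S.cluster i \ (L ∪ X) | S.side v = true} =
      #{v ∈ S.cluster i \ (L ∪ X) | S.side v = false}) :
    S.IsDecomposition G d t (μ / κ + η / κ ^ 2) ζ γ L X := by
  have hn : (0 : ℝ) < Fintype.card V := Nat.cast_pos.2 Fintype.card_pos
  have hlarge {i : ι} (hi : i ∈ S.indices) : κ * Fintype.card V ≤ #(S.cluster i \ (L ∪ X)) :=
    hS.le_card_cluster_sdiff hi (hM.trans (by gcongr))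
  refine ⟨fun i hi => ?_, fun i hi => hS.le_averageDegree hG hκ hM (hlarge hi), fun i hi => ?_,
    fun i hi => ?_, hpack⟩
  · exact card_pos.1 (Nat.cast_pos.1 ((mul_pos hκ hn).trans_le (hlarge hi)))
  · refine (hT i hi).1.induce_sdiff (μ := ζ) hζ (by linarith) ?_
    calc (#(L ∪ X) : ℝ) ≤ κ * ζ * Fintype.card V := hM.trans (by gcongr)
      _ = ζ * (κ * Fintype.card V) := by ring
      _ ≤ ζ * #(S.cluster i \ (L ∪ X)) := by gcongr; exact hlarge hi
  · refine (hT i hi).2.imp (fun hb => ?_) fun hfar => hfar.induce_sdiff ?_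
    · exact isBalancedBipartite_induce_kept hb sdiff_subset (hbal i hb)
    · calc γ * (Fintype.card V : ℝ) ^ 2 + #(L ∪ X) * (Fintype.card V : ℝ)
          ≤ γ * (Fintype.card V : ℝ) ^ 2 + γ * Fintype.card V * (Fintype.card V : ℝ) := by
            gcongr
            exact hM.trans (by gcongr)
        _ = 2 * γ * (Fintype.card V : ℝ) ^ 2 := by ring

end Parts

lemma exists_isDecomposition {f₁ f₂ : ℝ → ℝ} (hf₁ : IsHierarchyFunction f₁)
    (hf₂ : IsHierarchyFunction f₂) {u c : ℝ} (hu : 0 < u) (hc : 0 < c) {t : ℕ} (ht : 2 ≤ t) :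
    ∃ η₁ > 0, ∃ N : ℕ, ∀ (V : Type u) [Fintype V] [Nonempty V] (G : SimpleGraph V) (d : ℕ),
      N ≤ Fintype.card V → (∀ v, G.degree v = d) → c * Fintype.card V ≤ d →
      ∃ (η ζ γ : ℝ) (S : Labelling V (Fin (⌈1 / c⌉₊ + 1))) (L X : Finset V),
        η₁ ≤ η ∧ 0 < ζ ∧ 0 < γ ∧ η ≤ f₁ ζ ∧ ζ ≤ f₂ γ ∧ γ ≤ u ∧ ζ ≤ 1 / 4 ∧
        #S.indices ≤ ⌈1 / c⌉₊ ∧ (#X : ℝ) ≤ 16 / ζ ∧ S.IsDecomposition G d t η ζ γ L X := by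
  set R := ⌈1 / c⌉₊
  obtain ⟨δ, hδ, hδc⟩ : ∃ δ : ℝ, 0 < δ ∧ 4 ^ (2 * R) * δ = c :=
    ⟨c / 4 ^ (2 * R), by positivity, by field_simp⟩
  obtain ⟨C, θ, hθ, N, hbal⟩ := exists_balanced (Fin (R + 1)) hc hδ ht
  set κ := δ / 2 with hκ_def
  have hκ : 0 < κ := half_pos hδ
  set a := 2 * t / c + 1 with ha
  set b := a / κ + 1 / κ ^ 2 with hb
  obtain ⟨η₀, hη₀, hterm⟩ := exists_isTerminal (IsHierarchy f₁ f₂ u a b κ θ C)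
    (fun e he => exists_isHierarchy hf₁ hf₂ hu hκ hθ he) hc hδ (Nat.le_ceil (1 / c)) (2 * R)
  refine ⟨b * η₀, by positivity, N + ⌈C / η₀⌉₊, fun V _ _ G d hV hG hd => ?_⟩
  have hgood : (single V (0 : Fin (R + 1))).IsGood G η₀ (4 ^ (2 * R) * δ) :=
    isGood_single hη₀.le fun v => by rw [hδc, hG]; exact hd
  have hpot : 2 * R < (single V (0 : Fin (R + 1))).potential + 2 * R := by
    have := (single V (0 : Fin (R + 1))).card_indices_pos
    unfold potential
    omega
  obtain ⟨η, ζ, γ, S, hη, hζ, hγ, hscale, hS, hR, hT⟩ := hterm V G d _ hG hd hgood hpot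
  obtain ⟨L, X, hX, hL, hpack, hside⟩ := hbal V G d S η (by omega) hG hd hscale.eta_le hS
  have hconst : C ≤ η * Fintype.card V := by
    refine ((div_le_iff₀' hη₀).1 (Nat.ceil_le.1 ?_)).trans (by gcongr)
    omega
  have hM : (#(L ∪ X) : ℝ) ≤ a * η * Fintype.card V :=
    calc (#(L ∪ X) : ℝ) ≤ #L + #X := mod_cast card_union_le L X
      _ ≤ 2 * t * (η / c * Fintype.card V) + η * Fintype.card V :=
          add_le_add hL (hX.trans hconst)
      _ = a * η * Fintype.card V := by rw [ha]; ring
  have hdec := hS.isDecomposition hT hG hκ hζ.le hM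
    (by linarith [hscale.mul_eta_le]) hscale.mul_eta_le_mul_zeta hscale.mul_eta_le_gamma hpack hside
  have hbη : a * η / κ + η / κ ^ 2 = b * η := by rw [hb]; ring
  exact ⟨b * η, ζ, γ, S, L, X, by gcongr, hζ, hγ, hscale.mul_eta_le_apply, hscale.zeta_le_apply,
    hscale.gamma_le, hscale.zeta_le, hR,
    hX.trans ((le_div_iff₀ hζ).2 hscale.const_mul_zeta_le), hbη ▸ hdec⟩

lemma exists_isDecomposition_hierarchy {f₀ f₁ f₂ : ℝ → ℝ} (hf₀ : IsHierarchyFunction f₀)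
    (hf₁ : IsHierarchyFunction f₁) (hf₂ : IsHierarchyFunction f₂) {u c : ℝ} (hu : 0 < u)
    (hc : 0 < c) (hc₁ : c ≤ 1) {t : ℕ} (ht : 2 ≤ t) :
    ∃ N : ℕ, ∀ n₀ ≥ N, ∀ (V : Type u) [Fintype V] [Nonempty V] (G : SimpleGraph V) (d : ℕ),
      n₀ ≤ Fintype.card V → (∀ v, G.degree v = d) → c * Fintype.card V ≤ d →
      ∃ (η ζ γ : ℝ) (S : Labelling V (Fin (⌈1 / c⌉₊ + 1))) (L X : Finset V),
        0 < η ∧ 0 < ζ ∧ 0 < γ ∧ 1 / (n₀ : ℝ) ≤ f₀ η ∧ η ≤ f₁ ζ ∧ ζ ≤ f₂ γ ∧ γ ≤ u ∧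
        #S.indices ≤ ⌈1 / c⌉₊ ∧
        #X ≤ 64 * (#S.indices : ℝ) ^ 2 * (t / c) * (Real.exp 1 / (8 * ζ)) ^ t ∧
        S.IsDecomposition G d t η ζ γ L X := by
  obtain ⟨η₁, hη₁, N, hdec⟩ := exists_isDecomposition hf₁ hf₂ hu hc ht
  have hη₁' : min η₁ 1 ∈ Set.Ioc (0 : ℝ) 1 := ⟨lt_min hη₁ one_pos, min_le_right _ _⟩
  refine ⟨N + ⌈1 / f₀ (min η₁ 1)⌉₊, fun n₀ hn₀ V _ _ G d hV hG hd => ?_⟩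
  obtain ⟨η, ζ, γ, S, L, X, hη, hζ, hγ, hηζ, hζγ, hγu, hζ₄, hr, hX, hS⟩ :=
    hdec V G d (by omega) hG hd
  have hη_one : η ≤ 1 := hηζ.trans (hf₁.mapsTo ⟨hζ, hζ₄.trans (by norm_num)⟩).2
  exact ⟨η, ζ, γ, S, L, X, hη₁.trans_le hη, hζ, hγ,
    hf₀.one_div_le hη₁' ((min_le_left _ _).trans hη) hη_one (by omega), hηζ, hζγ, hγu, hr,
    hX.trans (sixteen_div_le_mul_exp_div_pow hc hc₁ hζ hζ₄ (by omega) S.card_indices_pos), hS⟩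

end Labelling

end DenseRegular

open DenseRegular Labelling in
theorem mainTheorem5
    (f₀ f₁ f₂ f₃ : ℝ → ℝ)
    (hf₀ : DenseRegular.IsHierarchyFunction f₀) (hf₁ : DenseRegular.IsHierarchyFunction f₁)
    (hf₂ : DenseRegular.IsHierarchyFunction f₂) (hf₃ : DenseRegular.IsHierarchyFunction f₃)
    (c : ℝ) (hc₀ : 0 < c) (hc₁ : c ≤ 1) (t : ℕ) (ht : 2 ≤ t) :
    ∃ N : ℕ, ∀ n₀ : ℕ, N ≤ n₀ →
      ∀ (V : Type*) [Fintype V] [DecidableEq V] (G : SimpleGraph V) [DecidableRel G.Adj]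
        (n d : ℕ), Fintype.card V = n → n₀ ≤ n → c * (n : ℝ) ≤ (d : ℝ) →
        G.IsRegularOfDegree d →
      ∃ (η ζ γ : ℝ) (r : ℕ),
        0 < η ∧ 0 < ζ ∧ 0 < γ ∧ 0 < r ∧ r ≤ ⌈1 / c⌉₊ ∧
        -- `1 / n₀ ≪ η ≪ ζ ≪ γ ≪ c, 1 / t`
        1 / (n₀ : ℝ) ≤ f₀ η ∧ η ≤ f₁ ζ ∧ ζ ≤ f₂ γ ∧ γ ≤ f₃ (min c (1 / (t : ℝ))) ∧
        ∃ (Z : Fin r → Finset V) (L : Finset V) (G' : SimpleGraph V),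
          (∀ i, (Z i).Nonempty) ∧
          (∀ i j, i ≠ j → Disjoint (Z i) (Z j)) ∧
          (∀ i, Disjoint (Z i) L) ∧
          G' ≤ G ∧
          ((Finset.univ \ (Finset.univ.biUnion Z ∪ L)).card : ℝ) ≤
            64 * (r : ℝ) ^ 2 * ((t : ℝ) / c) * (Real.exp 1 / (8 * ζ)) ^ t ∧
          (∀ i, (d : ℝ) - η * ((Z i).card : ℝ) ≤
            DenseRegular.averageDegree (G'.induce (Z i : Set V))) ∧
          (∀ i, DenseRegular.NoSparseCuts (G'.induce (Z i : Set V)) ζ) ∧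
          (∀ i, DenseRegular.IsBalancedBipartite (G'.induce (Z i : Set V)) ∨
            DenseRegular.IsFarFromBipartite (G'.induce (Z i : Set V)) (γ * (n : ℝ) ^ 2)) ∧
          DenseRegular.HasPerfectPacking (completeBipartiteGraph (Fin t) (Fin t))
            (G.induce (L : Set V)) := by
  have hu : 0 < f₃ (min c (1 / (t : ℝ))) :=
    (hf₃.mapsTo ⟨by positivity, (min_le_left _ _).trans hc₁⟩).1
  obtain ⟨N, hdec⟩ := exists_isDecomposition_hierarchy hf₀ hf₁ hf₂ hu hc₀ hc₁ ht
  refine ⟨N + 1, fun n₀ hn₀ V _ inst G _ n d hn hn₀n hd hG => ?_⟩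
  obtain rfl : inst = fun a b => Classical.propDecidable (a = b) := Subsingleton.elim _ _
  classical
  subst hn
  have : Nonempty V := Fintype.card_pos_iff.1 (by omega)
  obtain ⟨η, ζ, γ, S, L, X, hη, hζ, hγ, hnη, hηζ, hζγ, hγu, hr, hX, hS⟩ :=
    hdec n₀ (by omega) V G d hn₀n (fun v => by convert hG v) hd
  let e := S.indices.equivFin.symm
  refine ⟨η, ζ, γ, S.indices.card, hη, hζ, hγ, S.card_indices_pos, hr, hnη, hηζ, hζγ, hγu,
    fun j => S.cluster (e j).1 \ (L ∪ X), L, S.kept G, fun j => hS.nonempty _ (e j).2,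
    fun i j hij => ?_, fun j => Finset.sdiff_disjoint.mono_right Finset.subset_union_left, kept_le,
    (Nat.cast_le.2 (Finset.card_le_card (sdiff_biUnion_cluster_subset e L X))).trans hX,
    fun j => hS.le_averageDegree _ (e j).2, fun j => hS.noSparseCuts _ (e j).2,
    fun j => hS.isBalancedBipartite_or_isFarFromBipartite _ (e j).2,
    hS.hasPackingOn.hasPerfectPacking_induce⟩
  exact (disjoint_cluster fun h => hij (e.injective (Subtype.ext h))).mono Finset.sdiff_subset
    Finset.sdiff_subset
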